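/- Let $P\subset\mathbb R^3$ be a (not necessarily convex) polyhedron with $f$ triangular faces $F_1,\dots,F_f$ (its boundary is triangulated face to face by them; adjacent ones may be coplanar) whose vertices all lie on the unit sphere and which is star-shaped with respect to the centre of the sphere; let $v(P)$ be its volume. Let $\tau_i$ be the spherical area of the central projection of $F_i$ to the unit sphere, and $c_i$ the maximal arc length of an edge of $F_i$, i.e. the largest angle subtended at the centre by an edge of $F_i$. Put $$v(\tau,c)=\frac16\sin c\,\frac{\cos\frac{\tau-c}{2}-\cos\frac{\tau}{2}\cos\frac{c}{2}}{1-\cos\frac{c}{2}\cos\frac{\tau}{2}},$$ and for $0<\tau<\pi/2$ let $\varphi(\tau)$ be the zero in $\tau<c<\pi$ of the Hessian determinant $v_{\tau\tau}v_{cc}-v_{\tau c}^2$ at $(\tau,c)$ (the first one above $c=\tau$). Suppose that $0<\tau_i<\pi/2$ for all $i$, and that for some $0\le f'\le f$ we have $$\tau_i\le c_i\le\min\{\varphi(\tau_i),2\arcsin\sqrt{2/3}\}\quad (1\le i\le f'),\qquad 0<\varphi(\tau_j)\le c_j\le 2\arcsin\sqrt{2/3}\quad (f'<j\le f).$$ Let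 $c'=\frac1{f'}\sum_{i=1}^{f'}c_i$ and $c^\star=\frac1{f-f'}\sum_{i=f'+1}^{f}\varphi(\tau_i)$ (the product $f'c'$ resp. $(f-f')c^\star$ is read as $0$ when the corresponding class of faces is empty). Then $$v(P)\le \frac f6\,\sin\!\left(\frac{f'c'+(f-f')c^\star}{f}\right)\frac{\cos\left(\frac{4\pi-f'c'-(f-f')c^\star}{2f}\right)-\cos\frac{2\pi}{f}\cos\left(\frac{f'c'+(f-f')c^\star}{2f}\right)}{1-\cos\frac{4\pi}{2f}\cos\left(\frac{f'c'+(f-f')c^\star}{2f}\right)},$$ that is, $v(P)\le f\cdot v\!\left(\frac{4\pi}{f},\frac{f'c'+(f-f')c^\star}{f}\right)$. In particular, if $f'=f$, then $$v(P)\le \frac f6\,\sin c'\,\frac{\cos\left(\frac{2\pi}{f}-\frac{c'}{2}\right)-\cos\frac{2\pi}{f}\cos\frac{c'}{2}}{1-\cos\frac{c'}{2}\cos\frac{2\pi}{f}}.$$ -/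

import Mathlib

open MeasureTheory

noncomputable section

/-- Euclidean three-space. -/
abbrev E3 : Type := EuclideanSpace ℝ (Fin 3)

/-- A triangular polyhedron with `f` faces which is inscribed in the unit sphere and star-shaped
with respect to the centre of the sphere. It is a compact body (the closure of its nonempty
interior) whose boundary is the union of `f` triangles that meet face to face; every vertex lies
on the unit sphere. (Three distinct points of a sphere are never collinear, so the triangles are
not degenerate.) Convexity is not required. -/
structure InscribedStarPolyhedron (f : ℕ) where
  /-- the solid body -/
  body : Set E3
  /-- the vertex sets of the faces `F₁, …, F_f` -/
  face : Fin f → Finset E3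
  isCompact_body : IsCompact body
  interior_nonempty : (interior body).Nonempty
  closure_interior : closure (interior body) = body
  starConvex : StarConvex ℝ 0 body
  card_face : ∀ i, (face i).card = 3
  norm_vertex : ∀ i, ∀ x ∈ face i, ‖x‖ = 1
  face_injective : Function.Injective face
  inter_face : ∀ i j,
    convexHull ℝ (face i : Set E3) ∩ convexHull ℝ (face j : Set E3) ⊆
      convexHull ℝ ((face i : Set E3) ∩ (face j : Set E3))
  frontier_body : frontier body = ⋃ i, convexHull ℝ (face i : Set E3)

/-- The central projection of a set to the unit sphere. -/
def centralProjection (S : Set E3) : Set (Metric.sphere (0 : E3) 1) :=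
  {u | ∃ r : ℝ, 0 < r ∧ r • (u : E3) ∈ S}

/-- The surface area on the unit sphere (total mass `4π`) of the central projection of a set. -/
def sphericalArea (S : Set E3) : ℝ :=
  (volume : Measure E3).toSphere.real (centralProjection S)

/-- The maximal arc length (angle seen from the centre) between two points of a finite set. -/
def maxArc (F : Finset E3) : ℝ :=
  sSup {d : ℝ | ∃ x ∈ F, ∃ y ∈ F, d = InnerProductGeometry.angle x y}

namespace InscribedStarPolyhedron

variable {f : ℕ}

/-- The volume `v(P)`. -/
def vol (P : InscribedStarPolyhedron f) : ℝ :=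
  volume.real P.body

/-- The spherical area `τ_i` of the spherical triangle belonging to the `i`-th face. -/
def tau (P : InscribedStarPolyhedron f) (i : Fin f) : ℝ :=
  sphericalArea (convexHull ℝ (P.face i : Set E3))

/-- The maximal spherical edge length `c_i` of the `i`-th face. -/
def maxEdge (P : InscribedStarPolyhedron f) (i : Fin f) : ℝ :=
  maxArc (P.face i)

end InscribedStarPolyhedron

/-- The function `v(τ, c)`. -/
def facialBound (τ c : ℝ) : ℝ :=
  1 / 6 * Real.sin c *
    ((Real.cos ((τ - c) / 2) - Real.cos (τ / 2) * Real.cos (c / 2)) /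
      (1 - Real.cos (c / 2) * Real.cos (τ / 2)))

/-- The Hessian determinant of `v(τ, c)`. -/
def facialHessian (τ c : ℝ) : ℝ :=
  deriv (fun s => deriv (fun t => facialBound t c) s) τ *
      deriv (fun d => deriv (fun e => facialBound τ e) d) c -
    (deriv (fun t => deriv (fun d => facialBound t d) c) τ) ^ 2

/-- The function `f(τ)`, given by the zero of the Hessian of `v(τ, ·)` beyond the diagonal
`c = τ` (it is the upper boundary of the concavity domain of `v`). -/
def hessianZero (τ : ℝ) : ℝ :=
  sInf {c : ℝ | τ < c ∧ c < Real.pi ∧ facialHessian τ c = 0}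

/-- The constant `2 arcsin √(2/3)`, the arc length of an edge of the inscribed regular
tetrahedron. -/
def tetraEdge : ℝ :=
  2 * Real.arcsin (Real.sqrt (2 / 3))

end

/-!
Write `v(τ, c)` for `facialBound τ c`. The volume of the polyhedron is at most the sum of the volumes
of the tetrahedra spanned by the centre and the faces (`InscribedStarPolyhedron.vol_le`), and the
spherical areas `τ_i` add up to `4π` (`InscribedStarPolyhedron.sum_tau`). It remains to bound each
tetrahedron by `v(τ_i, c_i)` and to apply Jensen's inequality.

*One tetrahedron.* For unit vectors `A, B, C` with determinant `D > 0` and inner products `x, y, z`,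
Girard's theorem shows that half the area of the spherical triangle is the argument of
`(1 + x + y + z) + iD`. Girard's theorem itself is inclusion and exclusion for three half spaces
(`volume_trihedron`), given that the volume of a lune is proportional to its angle (`volume_lune`).
In these terms `D / 6 ≤ v(τ, c)`, with `c` the length of the side `AB`, is the inequality between the
arithmetic and the geometric mean of `1 + x` and `1 + y` (`triple_le_facialBound`).

*Concavity.* Put `q = cos (τ / 2)` and `k = cos (c / 2)`. The Hessian determinant of `v` is a positive
multiple of `3k - k³ - q (1 + 3k²) + 2k³q²` (`halfBound_hessian`, `cofactorPoly_pos`). With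
`A = tan (τ / 4)` and `B = tan (c / 4)` its sign is the sign of `A² (A² + 3B²) - B⁴ (B² + 3A²)`. The
logarithm of the quotient of these two terms is quasiconcave in `(τ, c)`, so the region where the
Hessian determinant is nonnegative is convex (`convex_concavityDomain`) and `v` is concave on it
(`concaveOn_halfBound`). All points `(τ, c)` with `τ ≤ c ≤ φ(τ)` lie in this region.

*Long edges.* Where the Hessian determinant vanishes, `v` is already nonincreasing in `c`
(`slope_nonneg_of_concavityPoly_eq_zero`) and it stays so. Hence `c_j` may be replaced by `φ(τ_j)`
when `c_j ≥ φ(τ_j)` (`facialBound_le_hessianZero`), and Jensen's inequality applies to all faces.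
-/

section

open scoped Pointwise

/-! ### Partial derivatives of the facial bound -/

/-- Six times the function `v(τ, c)`, written in the half angles `a = τ / 2` and `b = c / 2`. -/
noncomputable def halfBound (a b : ℝ) : ℝ :=
  2 * Real.cos b * (1 - Real.cos b ^ 2) * Real.sin a / (1 - Real.cos a * Real.cos b)

/-- The partial derivative of `halfBound` in its first variable. -/
noncomputable def halfBoundA (a b : ℝ) : ℝ :=
  2 * Real.cos b * (1 - Real.cos b ^ 2) * (Real.cos a - Real.cos b) / (1 - Real.cos a * Real.cos b) ^ 2

/-- The partial derivative of `halfBound` in its second variable. -/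
noncomputable def halfBoundB (a b : ℝ) : ℝ :=
  -(2 * Real.sin b * Real.sin a * (1 - 3 * Real.cos b ^ 2 + 2 * Real.cos b ^ 3 * Real.cos a)
    / (1 - Real.cos a * Real.cos b) ^ 2)

/-- The second partial derivative of `halfBound` in its first variable. -/
noncomputable def halfBoundAA (a b : ℝ) : ℝ :=
  -(2 * Real.cos b * (1 - Real.cos b ^ 2) * Real.sin a *
    (1 + Real.cos b * Real.cos a - 2 * Real.cos b ^ 2) / (1 - Real.cos a * Real.cos b) ^ 3)

/-- The polynomial in `k = cos b` and `q = cos a` that appears in the mixed second derivative of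
`halfBound`. -/
noncomputable def mixedPoly (k q : ℝ) : ℝ :=
  q - 2 * k + k * q ^ 2 - 3 * k ^ 2 * q + 4 * k ^ 3 + k ^ 3 * q ^ 2 - 2 * k ^ 4 * q

/-- The polynomial in `k = cos b` and `q = cos a` that appears in the second derivative of
`halfBound` in `b`. -/
noncomputable def secondPoly (k q : ℝ) : ℝ :=
  7 * k - 2 * q - 5 * k ^ 2 * q - 9 * k ^ 3 + 2 * k ^ 3 * q ^ 2 + 11 * k ^ 4 * q - 4 * k ^ 5 * q ^ 2

/-- The mixed second partial derivative of `halfBound`. -/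
noncomputable def halfBoundAB (a b : ℝ) : ℝ :=
  -(2 * Real.sin b * mixedPoly (Real.cos b) (Real.cos a) / (1 - Real.cos a * Real.cos b) ^ 3)

/-- The second partial derivative of `halfBound` in its second variable. -/
noncomputable def halfBoundBB (a b : ℝ) : ℝ :=
  -(2 * Real.sin a * secondPoly (Real.cos b) (Real.cos a) / (1 - Real.cos a * Real.cos b) ^ 3)

theorem hasDerivAt_halfBound {a b : ℝ → ℝ} {x y t : ℝ} (ha : HasDerivAt a x t)
    (hb : HasDerivAt b y t) (hu : 1 - Real.cos (a t) * Real.cos (b t) ≠ 0) :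
    HasDerivAt (fun t => halfBound (a t) (b t))
      (halfBoundA (a t) (b t) * x + halfBoundB (a t) (b t) * y) t := by
  have h := ((((hb.cos.const_mul 2).mul ((hb.cos.pow 2).const_sub 1)).mul ha.sin).div
    ((ha.cos.mul hb.cos).const_sub 1) hu)
  refine h.congr_deriv ?_
  have hs := Real.sin_sq_add_cos_sq (a t)
  simp only [halfBoundA, halfBoundB, Pi.mul_apply, Pi.pow_apply]
  clear h
  generalize Real.cos (a t) = q at *
  generalize Real.cos (b t) = k at *
  generalize Real.sin (a t) = s at *
  generalize Real.sin (b t) = w at *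
  obtain ⟨u, hq⟩ : ∃ u, u = 1 - q * k := ⟨_, rfl⟩
  rw [← hq] at hu ⊢
  field_simp
  subst hq
  linear_combination (-1) * k * (1 - k^2) * k * x * hs

theorem hasDerivAt_halfBoundA {a b : ℝ → ℝ} {x y t : ℝ} (ha : HasDerivAt a x t)
    (hb : HasDerivAt b y t) (hu : 1 - Real.cos (a t) * Real.cos (b t) ≠ 0) :
    HasDerivAt (fun t => halfBoundA (a t) (b t))
      (halfBoundAA (a t) (b t) * x + halfBoundAB (a t) (b t) * y) t := by
  have h := ((((hb.cos.const_mul 2).mul ((hb.cos.pow 2).const_sub 1)).mul (ha.cos.sub hb.cos)).div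
    (((ha.cos.mul hb.cos).const_sub 1).pow 2) (pow_ne_zero 2 hu))
  refine h.congr_deriv ?_
  simp only [halfBoundAA, halfBoundAB, mixedPoly, Pi.mul_apply, Pi.pow_apply, Pi.sub_apply]
  clear h
  generalize Real.cos (a t) = q at *
  generalize Real.cos (b t) = k at *
  generalize Real.sin (a t) = s at *
  generalize Real.sin (b t) = w at *
  obtain ⟨u, hq⟩ : ∃ u, u = 1 - q * k := ⟨_, rfl⟩
  rw [← hq] at hu ⊢
  field_simp
  subst hq
  ring

theorem hasDerivAt_halfBoundB {a b : ℝ → ℝ} {x y t : ℝ} (ha : HasDerivAt a x t)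
    (hb : HasDerivAt b y t) (hu : 1 - Real.cos (a t) * Real.cos (b t) ≠ 0) :
    HasDerivAt (fun t => halfBoundB (a t) (b t))
      (halfBoundAB (a t) (b t) * x + halfBoundBB (a t) (b t) * y) t := by
  have h := ((((hb.sin.const_mul 2).mul ha.sin).mul ((((hb.cos.pow 2).const_mul 3).const_sub 1).add
    (((hb.cos.pow 3).const_mul 2).mul ha.cos))).div
    (((ha.cos.mul hb.cos).const_sub 1).pow 2) (pow_ne_zero 2 hu)).neg
  refine h.congr_deriv ?_
  have hs := Real.sin_sq_add_cos_sq (a t)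
  have hw := Real.sin_sq_add_cos_sq (b t)
  simp only [halfBoundAB, halfBoundBB, mixedPoly, secondPoly, Pi.mul_apply, Pi.pow_apply,
    Pi.add_apply]
  clear h
  generalize Real.cos (a t) = q at *
  generalize Real.cos (b t) = k at *
  generalize Real.sin (a t) = s at *
  generalize Real.sin (b t) = w at *
  obtain ⟨u, hq⟩ : ∃ u, u = 1 - q * k := ⟨_, rfl⟩
  rw [← hq] at hu ⊢
  have hs2 : s ^ 2 = 1 - q ^ 2 := by linarith
  have hw2 : w ^ 2 = 1 - k ^ 2 := by linarith
  field_simp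
  subst hq
  ring_nf
  simp only [show s ^ 2 = 1 - q ^ 2 from hs2, hw2]
  ring

/-! ### The Hessian determinant and its first zero -/

/-- The factor of the Hessian determinant that decides its sign, as a polynomial in `k = cos b` and
`q = cos a`. -/
noncomputable def concavityPoly (k q : ℝ) : ℝ := 3 * k - k ^ 3 - q * (1 + 3 * k ^ 2) + 2 * k ^ 3 * q ^ 2

/-- The complementary factor of the Hessian determinant; it is positive for `0 < k ≤ q ≤ 1`,
`k < 1`. -/
noncomputable def cofactorPoly (k q : ℝ) : ℝ := (k - 2 * k ^ 3) * (1 + q ^ 2) + q * (1 - 3 * k ^ 2 + 4 * k ^ 4)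

theorem cofactorPoly_pos {k q : ℝ} (hk : 0 < k) (hkq : k ≤ q) (hq : q ≤ 1) (hk1 : k < 1) :
    0 < cofactorPoly k q := by
  have h : cofactorPoly k q = k * (1 - q) ^ 2 + 2 * k ^ 3 * ((1 - k) ^ 2 - (1 - q) ^ 2)
      + (1 - k) ^ 2 * (q * (1 + 4 * k) + 4 * k ^ 2 * (q - k) + 2 * k ^ 3) := by
    unfold cofactorPoly; ring
  have h1 : 0 ≤ (1 - k) ^ 2 - (1 - q) ^ 2 := by nlinarith
  have h2 : 0 < (1 - k) ^ 2 := by have : 0 < 1 - k := by linarith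
                                  positivity
  have h3 : 0 ≤ q - k := by linarith
  have h4 : 0 < q := by linarith
  rw [h]
  positivity

theorem concavityPoly_diag_pos {k : ℝ} (hk : 0 < k) (hk1 : k < 1) : 0 < concavityPoly k k := by
  have h : concavityPoly k k = 2 * k * (1 - k ^ 2) ^ 2 := by unfold concavityPoly; ring
  have : 0 < 1 - k ^ 2 := by nlinarith
  rw [h]; positivity

/-- Factorisation of the Hessian determinant of `halfBound`. -/
theorem halfBound_hessian {a b : ℝ} (hu : 1 - Real.cos a * Real.cos b ≠ 0) :
    halfBoundAA a b * halfBoundBB a b - halfBoundAB a b ^ 2 =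
      4 * (1 - Real.cos b ^ 2) / (1 - Real.cos a * Real.cos b) ^ 5 *
        (concavityPoly (Real.cos b) (Real.cos a) * cofactorPoly (Real.cos b) (Real.cos a)) := by
  have hs := Real.sin_sq_add_cos_sq a
  have hw := Real.sin_sq_add_cos_sq b
  simp only [halfBoundAA, halfBoundAB, halfBoundBB, mixedPoly, secondPoly, concavityPoly,
    cofactorPoly]
  generalize Real.cos a = q at *
  generalize Real.cos b = k at *
  generalize Real.sin a = s at *
  generalize Real.sin b = w at *
  obtain ⟨u, hq⟩ : ∃ u, u = 1 - q * k := ⟨_, rfl⟩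
  rw [← hq] at hu ⊢
  have hs2 : s ^ 2 = 1 - q ^ 2 := by linarith
  have hw2 : w ^ 2 = 1 - k ^ 2 := by linarith
  rw [neg_mul_neg, div_mul_div_comm, neg_sq, div_pow, div_mul_eq_mul_div, ← pow_add, ← pow_mul,
    div_sub_div_same, div_eq_div_iff (by positivity) (by positivity), mul_pow, mul_pow, hw2,
    show ∀ A B C D : ℝ, (A * s * B) * (C * s * D) = A * B * C * D * s ^ 2 by intros; ring, hs2]
  subst hq
  ring

theorem one_sub_cos_mul_cos_pos {a b : ℝ} (hb : 0 < b) (hb' : b < Real.pi) :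
    0 < 1 - Real.cos a * Real.cos b := by
  have h1 := Real.abs_cos_le_one a
  have h2 : |Real.cos b| < 1 := by
    have := Real.sin_pos_of_pos_of_lt_pi hb hb'
    rw [← sq_lt_one_iff_abs_lt_one]
    nlinarith [Real.sin_sq_add_cos_sq b]
  have h3 : |Real.cos a * Real.cos b| < 1 := by
    rw [abs_mul]
    nlinarith [abs_nonneg (Real.cos a), abs_nonneg (Real.cos b)]
  linarith [(abs_lt.1 h3).2]

theorem facialBound_eq_halfBound (τ c : ℝ) :
    facialBound τ c = 1 / 6 * halfBound (τ / 2) (c / 2) := by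
  have h1 : Real.sin c = 2 * Real.sin (c / 2) * Real.cos (c / 2) := by
    rw [← Real.sin_two_mul]; ring_nf
  have h2 : Real.cos ((τ - c) / 2) = Real.cos (τ / 2) * Real.cos (c / 2) +
      Real.sin (τ / 2) * Real.sin (c / 2) := by
    rw [← Real.cos_sub]; ring_nf
  have h3 := Real.sin_sq (c / 2)
  unfold facialBound halfBound
  rw [h1, h2, ← h3]
  ring

theorem hasDerivAt_facialBound_left {t c : ℝ}
    (hu : 1 - Real.cos (t / 2) * Real.cos (c / 2) ≠ 0) :
    HasDerivAt (fun t => facialBound t c) (1 / 12 * halfBoundA (t / 2) (c / 2)) t := by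
  have h := (hasDerivAt_halfBound ((hasDerivAt_id t).div_const 2) (hasDerivAt_const t (c / 2))
    hu).const_mul (1 / 6)
  simp only [facialBound_eq_halfBound]
  refine h.congr_deriv ?_
  simp only [id]; ring

theorem hasDerivAt_facialBound_right {t c : ℝ}
    (hu : 1 - Real.cos (t / 2) * Real.cos (c / 2) ≠ 0) :
    HasDerivAt (fun c => facialBound t c) (1 / 12 * halfBoundB (t / 2) (c / 2)) c := by
  have h := (hasDerivAt_halfBound (hasDerivAt_const c (t / 2)) ((hasDerivAt_id c).div_const 2)
    hu).const_mul (1 / 6)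
  simp only [facialBound_eq_halfBound]
  refine h.congr_deriv ?_
  simp only [id]; ring

theorem facialHessian_eq {τ c : ℝ} (hτ : 0 < τ) (hτ' : τ < Real.pi) (hc : 0 < c)
    (hc' : c < Real.pi) :
    facialHessian τ c = 1 / 576 * (halfBoundAA (τ / 2) (c / 2) * halfBoundBB (τ / 2) (c / 2) -
      halfBoundAB (τ / 2) (c / 2) ^ 2) := by
  have hu : ∀ t, 1 - Real.cos (t / 2) * Real.cos (c / 2) ≠ 0 := fun t =>
    (one_sub_cos_mul_cos_pos (by linarith) (by linarith)).ne'
  have hu' : ∀ d, 1 - Real.cos (τ / 2) * Real.cos (d / 2) ≠ 0 := fun d => by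
    rw [mul_comm]; exact (one_sub_cos_mul_cos_pos (by linarith) (by linarith)).ne'
  have h1 : deriv (fun s => deriv (fun t => facialBound t c) s) τ =
      1 / 24 * halfBoundAA (τ / 2) (c / 2) := by
    simp only [fun s => (hasDerivAt_facialBound_left (hu s)).deriv]
    refine (((hasDerivAt_halfBoundA ((hasDerivAt_id τ).div_const 2) (hasDerivAt_const τ (c / 2))
      (hu τ)).const_mul (1 / 12)).congr_deriv ?_).deriv
    simp only [id]; ring
  have h2 : deriv (fun d => deriv (fun e => facialBound τ e) d) c =
      1 / 24 * halfBoundBB (τ / 2) (c / 2) := by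
    simp only [fun d => (hasDerivAt_facialBound_right (hu' d)).deriv]
    refine (((hasDerivAt_halfBoundB (hasDerivAt_const c (τ / 2)) ((hasDerivAt_id c).div_const 2)
      (hu' c)).const_mul (1 / 12)).congr_deriv ?_).deriv
    simp only [id]; ring
  have h3 : deriv (fun t => deriv (fun d => facialBound t d) c) τ =
      1 / 24 * halfBoundAB (τ / 2) (c / 2) := by
    simp only [fun s => (hasDerivAt_facialBound_right (hu s)).deriv]
    refine (((hasDerivAt_halfBoundB ((hasDerivAt_id τ).div_const 2) (hasDerivAt_const τ (c / 2))
      (hu τ)).const_mul (1 / 12)).congr_deriv ?_).deriv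
    simp only [id]; ring
  unfold facialHessian
  rw [h1, h2, h3]
  ring

theorem facialHessian_eq_zero_iff {τ c : ℝ} (hτ : 0 < τ) (hτc : τ ≤ c) (hc : c < Real.pi) :
    facialHessian τ c = 0 ↔ concavityPoly (Real.cos (c / 2)) (Real.cos (τ / 2)) = 0 := by
  have hu := one_sub_cos_mul_cos_pos (a := τ / 2) (b := c / 2) (by linarith) (by linarith)
  have hk : 0 < Real.cos (c / 2) := Real.cos_pos_of_mem_Ioo ⟨by linarith, by linarith⟩
  have hk1 : Real.cos (c / 2) < 1 := by
    rw [← Real.cos_zero]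
    exact Real.cos_lt_cos_of_nonneg_of_le_pi_div_two le_rfl (by linarith) (by linarith)
  have hkq : Real.cos (c / 2) ≤ Real.cos (τ / 2) :=
    Real.cos_le_cos_of_nonneg_of_le_pi (by linarith) (by linarith) (by linarith)
  have h1 : 0 < 1 - Real.cos (c / 2) ^ 2 := by nlinarith
  have h2 := (cofactorPoly_pos hk hkq (Real.cos_le_one _) hk1).ne'
  have h3 : 4 * (1 - Real.cos (c / 2) ^ 2) /
      (1 - Real.cos (τ / 2) * Real.cos (c / 2)) ^ 5 ≠ 0 := by positivity
  rw [facialHessian_eq hτ (by linarith) (by linarith) hc, halfBound_hessian hu.ne']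
  simp [h2, h3]

/-- Up to the first zero of the Hessian the sign is that of the diagonal `c = τ`, where
`concavityPoly` is positive. -/
theorem concavityPoly_nonneg_of_le_hessianZero {τ c : ℝ} (hτ : 0 < τ) (hτc : τ ≤ c)
    (hc : c ≤ hessianZero τ) (hcπ : c < Real.pi) :
    0 ≤ concavityPoly (Real.cos (c / 2)) (Real.cos (τ / 2)) := by
  by_contra! hneg
  have hcont : ContinuousOn (fun d : ℝ => concavityPoly (Real.cos (d / 2)) (Real.cos (τ / 2)))
      (Set.Icc τ c) := by
    unfold concavityPoly; fun_prop
  have hτ0 : 0 < concavityPoly (Real.cos (τ / 2)) (Real.cos (τ / 2)) := by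
    refine concavityPoly_diag_pos (Real.cos_pos_of_mem_Ioo ⟨by linarith, by linarith⟩) ?_
    rw [← Real.cos_zero]
    exact Real.cos_lt_cos_of_nonneg_of_le_pi_div_two le_rfl (by linarith) (by linarith)
  obtain ⟨d, hd, hd0⟩ := intermediate_value_Icc' hτc hcont ⟨hneg.le, hτ0.le⟩
  have hdτ : τ ≠ d := by rintro rfl; simp only at hd0; linarith
  have hdc : d ≠ c := by rintro rfl; simp only at hd0; linarith
  have hdlt : d < c := lt_of_le_of_ne hd.2 hdc
  have : hessianZero τ ≤ d := by
    refine csInf_le ⟨τ, fun e he => he.1.le⟩ ⟨lt_of_le_of_ne hd.1 hdτ, by linarith, ?_⟩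
    rw [facialHessian_eq_zero_iff hτ hd.1 (by linarith)]
    exact hd0
  linarith

/-- A positive `hessianZero τ` is not the junk value of an empty infimum, hence a genuine zero of
`concavityPoly`, by closedness of the zero set. -/
theorem concavityPoly_hessianZero {τ : ℝ} (hτ : 0 < τ) (h0 : 0 < hessianZero τ) :
    τ ≤ hessianZero τ ∧
      concavityPoly (Real.cos (hessianZero τ / 2)) (Real.cos (τ / 2)) = 0 := by
  set S := {c : ℝ | τ < c ∧ c < Real.pi ∧ facialHessian τ c = 0} with hS
  have hne : S.Nonempty := by
    by_contra h
    rw [Set.not_nonempty_iff_eq_empty] at h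
    have : hessianZero τ = 0 := by
      unfold hessianZero; rw [← hS, h, Real.sInf_empty]
    linarith
  have hbd : BddBelow S := ⟨τ, fun e he => he.1.le⟩
  refine ⟨le_csInf hne fun e he => he.1.le, ?_⟩
  have hcl : IsClosed {d : ℝ | concavityPoly (Real.cos (d / 2)) (Real.cos (τ / 2)) = 0} := by
    refine isClosed_eq ?_ continuous_const
    unfold concavityPoly; fun_prop
  have hsub : S ⊆ {d : ℝ | concavityPoly (Real.cos (d / 2)) (Real.cos (τ / 2)) = 0} :=
    fun d hd => (facialHessian_eq_zero_iff hτ hd.1.le hd.2.1).1 hd.2.2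
  exact closure_minimal hsub hcl (csInf_mem_closure hne hbd)

/-- The quantity `1 - 3k² + 2k³q` has the opposite sign to `∂v/∂c`: at a zero of the Hessian, `v` no
longer increases in `c`. -/
theorem slope_nonneg_of_concavityPoly_eq_zero {k q : ℝ} (hk : 0 < k) (hkq : k ≤ q) (hq : q ≤ 1)
    (hk1 : k < 1) (h : concavityPoly k q = 0) : 0 ≤ 1 - 3 * k ^ 2 + 2 * k ^ 3 * q := by
  by_contra! hN
  unfold concavityPoly at h
  have h1 : 0 < (1 - k ^ 2) ^ 3 := by
    have : 0 < 1 - k ^ 2 := by nlinarith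
    positivity
  have hk3 : 0 < k ^ 3 := by positivity
  -- division by `1 - 3k² + 2k³q`: were that negative, the right-hand side would be positive
  have key : k ^ 3 * (3 * k - k ^ 3 - q * (1 + 3 * k ^ 2) + 2 * k ^ 3 * q ^ 2) =
      (1 - k ^ 2) ^ 3 + (1 - 3 * k ^ 2 + 2 * k ^ 3 * q) * (q * k ^ 3 - 1) := by ring
  have : q * k ^ 3 - 1 ≤ 0 := by
    have : k ^ 3 ≤ 1 := pow_le_one₀ hk.le hk1.le
    nlinarith
  rw [h] at key
  nlinarith

/-! ### Convexity of the concavity domain and concavity of the facial bound -/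

/-- Once `b ↦ halfBound a b` has stopped increasing, it never exceeds the value reached there. -/
theorem halfBound_le_of_slope_nonneg {a b c : ℝ} (ha : 0 < a) (hab : a ≤ b) (hbc : b ≤ c)
    (hc : c < Real.pi / 2) (hN : 0 ≤ 1 - 3 * Real.cos b ^ 2 + 2 * Real.cos b ^ 3 * Real.cos a) :
    halfBound a c ≤ halfBound a b := by
  have hu := one_sub_cos_mul_cos_pos (a := a) (b := b) (by linarith) (by linarith)
  have hv := one_sub_cos_mul_cos_pos (a := a) (b := c) (by linarith) (by linarith)
  have hs : 0 ≤ Real.sin a := Real.sin_nonneg_of_nonneg_of_le_pi ha.le (by linarith)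
  have hk : 0 < Real.cos c := Real.cos_pos_of_mem_Ioo ⟨by linarith, by linarith⟩
  have hlk : Real.cos c ≤ Real.cos b :=
    Real.cos_le_cos_of_nonneg_of_le_pi (by linarith) (by linarith) hbc
  unfold halfBound
  rw [div_le_div_iff₀ hv hu]
  generalize Real.cos a = q at *
  generalize Real.cos b = k at *
  generalize Real.cos c = l at *
  have key : 2 * k * (1 - k ^ 2) * Real.sin a * (1 - q * l) -
      2 * l * (1 - l ^ 2) * Real.sin a * (1 - q * k) = 2 * Real.sin a * ((k - l) *
        ((1 - 3 * k ^ 2 + 2 * k ^ 3 * q) + (k - l) * (2 * k + l) * (1 - q * k))) := by ring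
  have h1 : 0 ≤ k - l := by linarith
  have h2 : 0 ≤ 2 * k + l := by linarith
  have := mul_nonneg (mul_nonneg zero_le_two hs) (mul_nonneg h1
    (add_nonneg hN (mul_nonneg (mul_nonneg h1 h2) hu.le)))
  linarith

/-- A function on `[0, 1]` that is nonnegative at both ends and whose second derivative is negative at
every critical point is nonnegative: its minimum cannot lie in the interior. This is how convexity of a
superlevel set is checked along segments. -/
theorem nonneg_of_critical_deriv2_neg {g g₁ g₂ : ℝ → ℝ}
    (h₁ : ∀ t ∈ Set.Icc (0 : ℝ) 1, HasDerivAt g (g₁ t) t)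
    (h₂ : ∀ t ∈ Set.Icc (0 : ℝ) 1, HasDerivAt g₁ (g₂ t) t)
    (hcrit : ∀ t ∈ Set.Ioo (0 : ℝ) 1, g₁ t = 0 → g₂ t < 0)
    (h0 : 0 ≤ g 0) (h1 : 0 ≤ g 1) {t : ℝ} (ht : t ∈ Set.Icc (0 : ℝ) 1) : 0 ≤ g t := by
  have hcont : ContinuousOn g (Set.Icc 0 1) := fun t ht => (h₁ t ht).continuousAt.continuousWithinAt
  obtain ⟨s, hs, hmin⟩ := isCompact_Icc.exists_isMinOn ⟨t, ht⟩ hcont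
  refine le_trans ?_ (hmin ht)
  by_contra! hneg
  have hs0 : s ≠ 0 := by rintro rfl; linarith
  have hs1 : s ≠ 1 := by rintro rfl; linarith
  have hsI : s ∈ Set.Ioo (0 : ℝ) 1 := ⟨lt_of_le_of_ne hs.1 hs0.symm, lt_of_le_of_ne hs.2 hs1⟩
  have hnhds : Set.Icc (0 : ℝ) 1 ∈ nhds s := Icc_mem_nhds hsI.1 hsI.2
  have hlmin : IsLocalMin g s := hmin.isLocalMin hnhds
  have hc := hlmin.hasDerivAt_eq_zero (h₁ s hs)
  have hneg2 := hcrit s hsI hc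
  have hd1 : deriv g =ᶠ[nhds s] g₁ := by
    filter_upwards [hnhds] with r hr using (h₁ r hr).deriv
  have hlmax : IsLocalMax g s := by
    refine isLocalMax_of_deriv_deriv_neg ?_ ?_ (h₁ s hs).continuousAt
    · rw [hd1.deriv_eq, (h₂ s hs).deriv]; exact hneg2
    · rw [(h₁ s hs).deriv, hc]
  have hconst : g =ᶠ[nhds s] fun _ => g s := by
    filter_upwards [hlmin, hlmax] with r hr hr' using le_antisymm hr' hr
  have h0' : g₁ =ᶠ[nhds s] fun _ => 0 := by
    have := hconst.deriv
    refine hd1.symm.trans (this.trans ?_)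
    simp [Filter.EventuallyEq]
  have := h0'.deriv_eq
  rw [(h₂ s hs).deriv] at this
  simp at this
  linarith

/-- The pairs of half angles `(a, b)`, `a ≤ b`, at which the Hessian determinant of `halfBound` is
nonnegative. -/
noncomputable def concavityDomain : Set (ℝ × ℝ) :=
  {p | 0 < p.1 ∧ p.1 ≤ p.2 ∧ p.2 < Real.pi / 2 ∧
    0 ≤ concavityPoly (Real.cos p.2) (Real.cos p.1)}

theorem tan_half_sq_mul (a : ℝ) (ha : 0 < a) (ha' : a < Real.pi) :
    Real.tan (a / 2) ^ 2 * (1 + Real.cos a) = 1 - Real.cos a := by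
  have hc : 0 < Real.cos (a / 2) := Real.cos_pos_of_mem_Ioo ⟨by linarith, by linarith⟩
  have h : Real.cos a = 2 * Real.cos (a / 2) ^ 2 - 1 := by rw [← Real.cos_two_mul]; ring_nf
  have hs := Real.sin_sq_add_cos_sq (a / 2)
  rw [Real.tan_eq_sin_div_cos, h]
  field_simp
  linear_combination 2 * Real.cos (a / 2) ^ 2 * hs

/-- With `A = tan (a / 2)` and `B = tan (b / 2)`, the logarithm of
`A² (A² + 3B²) / (B⁴ (B² + 3A²))`. Its sign is the sign of `concavityPoly`, and as a function of
`log A`, `log B` it is affine up to a function of `A / B`. -/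
noncomputable def concavityLog (a b : ℝ) : ℝ :=
  2 * Real.log (Real.tan (a / 2)) - 4 * Real.log (Real.tan (b / 2)) +
    (Real.log (Real.tan (a / 2) ^ 2 / Real.tan (b / 2) ^ 2 + 3) -
      Real.log (1 + 3 * (Real.tan (a / 2) ^ 2 / Real.tan (b / 2) ^ 2)))

theorem concavityPoly_nonneg_iff {a b : ℝ} (ha : 0 < a) (ha' : a < Real.pi) (hb : 0 < b)
    (hb' : b < Real.pi) :
    0 ≤ concavityPoly (Real.cos b) (Real.cos a) ↔ 0 ≤ concavityLog a b := by
  have hA : 0 < Real.tan (a / 2) := Real.tan_pos_of_pos_of_lt_pi_div_two (by linarith) (by linarith)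
  have hB : 0 < Real.tan (b / 2) := Real.tan_pos_of_pos_of_lt_pi_div_two (by linarith) (by linarith)
  have hα := tan_half_sq_mul a ha ha'
  have hβ := tan_half_sq_mul b hb hb'
  have hq : 0 < 1 + Real.cos a := by
    have : Real.cos Real.pi < Real.cos a :=
      Real.cos_lt_cos_of_nonneg_of_le_pi ha.le le_rfl ha'
    rw [Real.cos_pi] at this; linarith
  have hk : 0 < 1 + Real.cos b := by
    have : Real.cos Real.pi < Real.cos b :=
      Real.cos_lt_cos_of_nonneg_of_le_pi hb.le le_rfl hb'
    rw [Real.cos_pi] at this; linarith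
  unfold concavityLog
  generalize Real.tan (a / 2) = A at *
  generalize Real.tan (b / 2) = B at *
  generalize Real.cos a = q at *
  generalize Real.cos b = k at *
  have h1 : 2 * Real.log A - 4 * Real.log B + (Real.log (A ^ 2 / B ^ 2 + 3) -
      Real.log (1 + 3 * (A ^ 2 / B ^ 2))) =
      Real.log (A ^ 2 * (A ^ 2 / B ^ 2 + 3)) - Real.log (B ^ 4 * (1 + 3 * (A ^ 2 / B ^ 2))) := by
    rw [Real.log_mul (by positivity) (by positivity), Real.log_mul (by positivity) (by positivity),
      Real.log_pow, Real.log_pow]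
    push_cast; ring
  have h2 : A ^ 2 * (A ^ 2 / B ^ 2 + 3) - B ^ 4 * (1 + 3 * (A ^ 2 / B ^ 2)) =
      (A ^ 2 * (A ^ 2 + 3 * B ^ 2) - B ^ 4 * (B ^ 2 + 3 * A ^ 2)) / B ^ 2 := by
    field_simp
  have h3 : 4 * concavityPoly k q = (1 + q) ^ 2 * (1 + k) ^ 3 *
      (A ^ 2 * (A ^ 2 + 3 * B ^ 2) - B ^ 4 * (B ^ 2 + 3 * A ^ 2)) := by
    have e : (1 + q) ^ 2 * (1 + k) ^ 3 *
      (A ^ 2 * (A ^ 2 + 3 * B ^ 2) - B ^ 4 * (B ^ 2 + 3 * A ^ 2)) =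
      (A ^ 2 * (1 + q)) ^ 2 * (1 + k) ^ 3 +
      3 * (A ^ 2 * (1 + q)) * (1 + q) * (B ^ 2 * (1 + k)) * (1 + k) ^ 2 -
      (B ^ 2 * (1 + k)) ^ 3 * (1 + q) ^ 2 -
      3 * (B ^ 2 * (1 + k)) ^ 2 * (1 + k) * (A ^ 2 * (1 + q)) * (1 + q) := by ring
    rw [e, hα, hβ]
    unfold concavityPoly
    ring
  rw [h1, sub_nonneg, Real.log_le_log_iff (by positivity) (by positivity),
    ← sub_nonneg (a := A ^ 2 * _), h2,
    le_div_iff₀ (by positivity), zero_mul]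
  have h4 : 0 < (1 + q) ^ 2 * (1 + k) ^ 3 := by positivity
  constructor
  · intro h
    exact nonneg_of_mul_nonneg_right (by rw [← h3]; linarith) h4
  · intro h
    have := mul_nonneg h4.le h
    linarith

theorem hasDerivAt_tan_half {a : ℝ → ℝ} {x t : ℝ} (ha : HasDerivAt a x t) (h0 : 0 < a t)
    (h1 : a t < Real.pi) :
    HasDerivAt (fun t => Real.tan (a t / 2)) (Real.tan (a t / 2) * (x / Real.sin (a t))) t := by
  have hc : 0 < Real.cos (a t / 2) := Real.cos_pos_of_mem_Ioo ⟨by linarith, by linarith⟩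
  have hs : 0 < Real.sin (a t / 2) := Real.sin_pos_of_pos_of_lt_pi (by linarith) (by linarith)
  refine ((Real.hasDerivAt_tan hc.ne').comp t (ha.div_const 2)).congr_deriv ?_
  rw [Real.tan_eq_sin_div_cos, show Real.sin (a t) = 2 * Real.sin (a t / 2) * Real.cos (a t / 2) by
    rw [← Real.sin_two_mul]; ring_nf]
  field_simp

theorem hasDerivAt_div_sin {a : ℝ → ℝ} {x t : ℝ} (ha : HasDerivAt a x t) (h0 : 0 < a t)
    (h1 : a t < Real.pi) :
    HasDerivAt (fun t => x / Real.sin (a t))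
      (-Real.cos (a t) * (x / Real.sin (a t)) ^ 2) t := by
  have hs : 0 < Real.sin (a t) := Real.sin_pos_of_pos_of_lt_pi h0 h1
  refine ((hasDerivAt_const t x).div ha.sin hs.ne').congr_deriv ?_
  field_simp
  ring

/-- The second derivative of `concavityLog` along a line is negative at critical points. Here `X` and
`V` are the derivatives of `log A` and `log B`, `z = A² / B²`, and `ca`, `cb` are the cosines of `a`
and `b`. -/
theorem critical_second_deriv_neg {X V z ca cb : ℝ} (hz : 0 < z) (hz1 : z ≤ 1) (hca : 0 < ca)
    (hcb : cb ≤ ca) (hX : X ≠ 0 ∨ V ≠ 0)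
    (hcrit : 2 * X - 4 * V - 16 * z / ((z + 3) * (1 + 3 * z)) * (X - V) = 0) :
    2 * (-ca * X ^ 2) - 4 * (-cb * V ^ 2) -
      (48 * (1 - z ^ 2) / ((z + 3) * (1 + 3 * z)) ^ 2 * (2 * z * (X - V)) * (X - V) +
        16 * z / ((z + 3) * (1 + 3 * z)) * (-ca * X ^ 2 - -cb * V ^ 2)) < 0 := by
  have hm1 : 16 * z / ((z + 3) * (1 + 3 * z)) ≤ 1 := by
    rw [div_le_one (by positivity)]; nlinarith [sq_nonneg (z - 1)]
  have hn : 0 ≤ 48 * (1 - z ^ 2) / ((z + 3) * (1 + 3 * z)) ^ 2 * (2 * z * (X - V)) * (X - V) := by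
    have : 0 ≤ 1 - z ^ 2 := by nlinarith
    have e : 48 * (1 - z ^ 2) / ((z + 3) * (1 + 3 * z)) ^ 2 * (2 * z * (X - V)) * (X - V) =
      48 * (1 - z ^ 2) / ((z + 3) * (1 + 3 * z)) ^ 2 * (2 * z * (X - V) ^ 2) := by ring
    rw [e]; positivity
  generalize 48 * (1 - z ^ 2) / ((z + 3) * (1 + 3 * z)) ^ 2 * (2 * z * (X - V)) * (X - V) = n at *
  generalize 16 * z / ((z + 3) * (1 + 3 * z)) = m at *
  have hXV : (2 - m) * X = (4 - m) * V := by linarith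
  have hX0 : X ≠ 0 := by
    rintro rfl
    have : (4 - m) * V = 0 := by linarith
    rcases mul_eq_zero.1 this with h | h
    · linarith
    · simp [h] at hX
  have hV : V = (2 - m) / (4 - m) * X := by
    have : 4 - m ≠ 0 := by linarith
    field_simp; linarith
  have hr1 : (2 - m) / (4 - m) < 1 := by rw [div_lt_one (by linarith)]; linarith
  have hr0 : 0 < (2 - m) / (4 - m) := div_pos (by linarith) (by linarith)
  have e : (4 - m) * (cb * V ^ 2) = (2 - m) * (cb * (2 - m) / (4 - m) * X ^ 2) := by
    have : (4 - m) * (cb * V ^ 2) = cb * V * ((4 - m) * V) := by ring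
    rw [this, ← hXV, hV]; ring
  have hlt : cb * ((2 - m) / (4 - m)) < ca := by
    rcases le_or_gt cb 0 with h | h
    · nlinarith
    · nlinarith
  have hX2 : 0 < X ^ 2 := by positivity
  have : (2 - m) * (cb * (2 - m) / (4 - m) * X ^ 2) < (2 - m) * (ca * X ^ 2) := by
    refine mul_lt_mul_of_pos_left (mul_lt_mul_of_pos_right ?_ hX2) (by linarith)
    rwa [mul_div_assoc]
  nlinarith

theorem convex_concavityDomain : Convex ℝ concavityDomain := by
  rintro ⟨a₀, b₀⟩ ⟨ha₀, hab₀, hb₀, hp₀⟩ ⟨a₁, b₁⟩ ⟨ha₁, hab₁, hb₁, hp₁⟩ l t hl ht hlt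
  simp only at ha₀ hab₀ hb₀ hp₀ ha₁ hab₁ hb₁ hp₁
  by_cases hne : a₁ - a₀ = 0 ∧ b₁ - b₀ = 0
  · obtain rfl : a₁ = a₀ := by linarith [hne.1]
    obtain rfl : b₁ = b₀ := by linarith [hne.2]
    rw [← add_smul, hlt, one_smul]
    exact ⟨ha₀, hab₀, hb₀, hp₀⟩
  set a : ℝ → ℝ := fun s => a₀ + s * (a₁ - a₀) with hadef
  set b : ℝ → ℝ := fun s => b₀ + s * (b₁ - b₀) with hbdef
  have hmem : ∀ s ∈ Set.Icc (0 : ℝ) 1, 0 < a s ∧ a s ≤ b s ∧ b s < Real.pi / 2 := by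
    rintro s ⟨hs0, hs1⟩
    simp only [hadef, hbdef]
    rcases hs0.eq_or_lt with rfl | hs0
    · simp; exact ⟨ha₀, hab₀, hb₀⟩
    refine ⟨?_, ?_, ?_⟩ <;> nlinarith
  have hda : ∀ s, HasDerivAt a (a₁ - a₀) s := fun s => by
    exact (((hasDerivAt_id s).mul_const (a₁ - a₀)).const_add a₀).congr_deriv (one_mul _)
  have hdb : ∀ s, HasDerivAt b (b₁ - b₀) s := fun s => by
    exact (((hasDerivAt_id s).mul_const (b₁ - b₀)).const_add b₀).congr_deriv (one_mul _)
  have hπ := Real.pi_pos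
  set z : ℝ → ℝ := fun s => Real.tan (a s / 2) ^ 2 / Real.tan (b s / 2) ^ 2 with hzdef
  set X : ℝ → ℝ := fun s => (a₁ - a₀) / Real.sin (a s) with hXdef
  set V : ℝ → ℝ := fun s => (b₁ - b₀) / Real.sin (b s) with hVdef
  have htA : ∀ s ∈ Set.Icc (0 : ℝ) 1, 0 < Real.tan (a s / 2) := fun s hs =>
    Real.tan_pos_of_pos_of_lt_pi_div_two (by linarith [hmem s hs]) (by linarith [hmem s hs])
  have htB : ∀ s ∈ Set.Icc (0 : ℝ) 1, 0 < Real.tan (b s / 2) := fun s hs =>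
    Real.tan_pos_of_pos_of_lt_pi_div_two (by linarith [hmem s hs]) (by linarith [hmem s hs])
  have hz0 : ∀ s ∈ Set.Icc (0 : ℝ) 1, 0 < z s := fun s hs =>
    div_pos (pow_pos (htA s hs) 2) (pow_pos (htB s hs) 2)
  have hz1 : ∀ s ∈ Set.Icc (0 : ℝ) 1, z s ≤ 1 := fun s hs => by
    have : Real.tan (a s / 2) ≤ Real.tan (b s / 2) := by
      obtain ⟨h1, h2, h3⟩ := hmem s hs
      rcases h2.eq_or_lt with h | h
      · rw [h]
      · exact (Real.tan_lt_tan_of_nonneg_of_lt_pi_div_two (by linarith) (by linarith)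
          (by linarith)).le
    exact (div_le_one (pow_pos (htB s hs) 2)).2 (pow_le_pow_left₀ (htA s hs).le this 2)
  have hdA : ∀ s ∈ Set.Icc (0 : ℝ) 1, HasDerivAt (fun s => Real.tan (a s / 2))
      (Real.tan (a s / 2) * X s) s := fun s hs =>
    hasDerivAt_tan_half (hda s) (by linarith [hmem s hs]) (by linarith [hmem s hs])
  have hdB : ∀ s ∈ Set.Icc (0 : ℝ) 1, HasDerivAt (fun s => Real.tan (b s / 2))
      (Real.tan (b s / 2) * V s) s := fun s hs =>
    hasDerivAt_tan_half (hdb s) (by linarith [hmem s hs]) (by linarith [hmem s hs])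
  have hdz : ∀ s ∈ Set.Icc (0 : ℝ) 1, HasDerivAt z (2 * z s * (X s - V s)) s := fun s hs => by
    have hB := (htB s hs).ne'
    refine (((hdA s hs).pow 2).div ((hdB s hs).pow 2) (pow_ne_zero 2 hB)).congr_deriv ?_
    simp only [hzdef, Pi.pow_apply]
    field_simp
    ring
  have hdX : ∀ s ∈ Set.Icc (0 : ℝ) 1, HasDerivAt X (-Real.cos (a s) * X s ^ 2) s := fun s hs =>
    hasDerivAt_div_sin (hda s) (by linarith [hmem s hs]) (by linarith [hmem s hs])
  have hdV : ∀ s ∈ Set.Icc (0 : ℝ) 1, HasDerivAt V (-Real.cos (b s) * V s ^ 2) s := fun s hs =>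
    hasDerivAt_div_sin (hdb s) (by linarith [hmem s hs]) (by linarith [hmem s hs])
  have hg1 : ∀ s ∈ Set.Icc (0 : ℝ) 1, HasDerivAt (fun s => concavityLog (a s) (b s))
      (2 * X s - 4 * V s - 16 * z s / ((z s + 3) * (1 + 3 * z s)) * (X s - V s)) s := by
    intro s hs
    have hA := (htA s hs).ne'
    have hB := (htB s hs).ne'
    have hz := hz0 s hs
    have hz3 : z s + 3 ≠ 0 := by positivity
    have hz4 : 1 + 3 * z s ≠ 0 := by positivity
    refine (((((hdA s hs).log hA).const_mul 2).sub (((hdB s hs).log hB).const_mul 4)).add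
      ((((hdz s hs).add_const 3).log hz3).sub
        ((((hdz s hs).const_mul 3).const_add 1).log hz4))).congr_deriv ?_
    field_simp
    ring
  have hg2 : ∀ s ∈ Set.Icc (0 : ℝ) 1, HasDerivAt
      (fun s => 2 * X s - 4 * V s - 16 * z s / ((z s + 3) * (1 + 3 * z s)) * (X s - V s))
      (2 * (-Real.cos (a s) * X s ^ 2) - 4 * (-Real.cos (b s) * V s ^ 2) -
      (48 * (1 - z s ^ 2) / ((z s + 3) * (1 + 3 * z s)) ^ 2 * (2 * z s * (X s - V s)) *
        (X s - V s) + 16 * z s / ((z s + 3) * (1 + 3 * z s)) *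
          (-Real.cos (a s) * X s ^ 2 - -Real.cos (b s) * V s ^ 2))) s := by
    intro s hs
    have hz := hz0 s hs
    have hz3 : z s + 3 ≠ 0 := by positivity
    have hz4 : 1 + 3 * z s ≠ 0 := by positivity
    refine ((((hdX s hs).const_mul 2).sub ((hdV s hs).const_mul 4)).sub
      (((((hdz s hs).const_mul 16).div (((hdz s hs).add_const 3).mul
        (((hdz s hs).const_mul 3).const_add 1)) (mul_ne_zero hz3 hz4))).mul
          ((hdX s hs).sub (hdV s hs)))).congr_deriv ?_
    congr 1
    simp only [Pi.mul_apply, Pi.sub_apply, Pi.div_apply]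
    congr 1
    field_simp
    ring
  have hcrit : ∀ s ∈ Set.Icc (0 : ℝ) 1,
      0 ≤ concavityPoly (Real.cos (b s)) (Real.cos (a s)) ↔ 0 ≤ concavityLog (a s) (b s) :=
    fun s hs => concavityPoly_nonneg_iff (by linarith [hmem s hs]) (by linarith [hmem s hs])
      (by linarith [hmem s hs]) (by linarith [hmem s hs])
  have htI : t ∈ Set.Icc (0 : ℝ) 1 := ⟨ht, by linarith⟩
  have hmain := nonneg_of_critical_deriv2_neg hg1 hg2 (fun s hs h => by
    have hs' : s ∈ Set.Icc (0 : ℝ) 1 := Set.Ioo_subset_Icc_self hs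
    obtain ⟨h1, h2, h3⟩ := hmem s hs'
    refine critical_second_deriv_neg (hz0 s hs') (hz1 s hs')
      (Real.cos_pos_of_mem_Ioo ⟨by linarith, by linarith⟩)
      (Real.cos_le_cos_of_nonneg_of_le_pi h1.le (by linarith) h2) ?_ h
    have hsa : Real.sin (a s) ≠ 0 := (Real.sin_pos_of_pos_of_lt_pi h1 (by linarith)).ne'
    have hsb : Real.sin (b s) ≠ 0 := (Real.sin_pos_of_pos_of_lt_pi (by linarith)
      (by linarith)).ne'
    by_contra! hh
    exact hne ⟨by simpa [hXdef, hsa] using hh.1, by simpa [hVdef, hsb] using hh.2⟩)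
    ((hcrit 0 (by simp)).1 (by simpa [hadef, hbdef] using hp₀))
    ((hcrit 1 (by simp)).1 (by simpa [hadef, hbdef] using hp₁)) htI
  have hl' : l = 1 - t := by linarith
  have e : l • ((a₀, b₀) : ℝ × ℝ) + t • (a₁, b₁) = (a t, b t) := by
    simp only [Prod.smul_mk, Prod.mk_add_mk, smul_eq_mul, hadef, hbdef, hl']
    congr 1 <;> ring
  rw [e]
  obtain ⟨h1, h2, h3⟩ := hmem t htI
  exact ⟨h1, h2, h3, (hcrit t htI).2 hmain⟩

theorem concaveOn_halfBound :
    ConcaveOn ℝ concavityDomain (fun p : ℝ × ℝ => halfBound p.1 p.2) := by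
  refine ⟨convex_concavityDomain, ?_⟩
  rintro ⟨a₀, b₀⟩ h₀ ⟨a₁, b₁⟩ h₁ l t hl ht hlt
  set a : ℝ → ℝ := fun s => a₀ + s * (a₁ - a₀) with hadef
  set b : ℝ → ℝ := fun s => b₀ + s * (b₁ - b₀) with hbdef
  have e : ∀ l s : ℝ, l + s = 1 → l • ((a₀, b₀) : ℝ × ℝ) + s • (a₁, b₁) = (a s, b s) := by
    intro l s hls
    obtain rfl : l = 1 - s := by linarith
    simp only [Prod.smul_mk, Prod.mk_add_mk, smul_eq_mul, hadef, hbdef]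
    congr 1 <;> ring
  have hmem : ∀ s ∈ Set.Icc (0 : ℝ) 1, (a s, b s) ∈ concavityDomain := fun s hs => by
    rw [← e (1 - s) s (by ring)]
    exact convex_concavityDomain h₀ h₁ (by linarith [hs.2]) hs.1 (by ring)
  have hda : ∀ s, HasDerivAt a (a₁ - a₀) s := fun s => by
    exact (((hasDerivAt_id s).mul_const (a₁ - a₀)).const_add a₀).congr_deriv (one_mul _)
  have hdb : ∀ s, HasDerivAt b (b₁ - b₀) s := fun s => by
    exact (((hasDerivAt_id s).mul_const (b₁ - b₀)).const_add b₀).congr_deriv (one_mul _)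
  have hπ := Real.pi_pos
  have hu : ∀ s ∈ Set.Icc (0 : ℝ) 1, 0 < 1 - Real.cos (a s) * Real.cos (b s) := fun s hs => by
    obtain ⟨h1, h2, h3, -⟩ := hmem s hs
    exact one_sub_cos_mul_cos_pos (by linarith) (by linarith)
  have hF : ∀ s ∈ Set.Icc (0 : ℝ) 1, HasDerivAt (fun s => halfBound (a s) (b s))
      (halfBoundA (a s) (b s) * (a₁ - a₀) + halfBoundB (a s) (b s) * (b₁ - b₀)) s :=
    fun s hs => hasDerivAt_halfBound (hda s) (hdb s) (hu s hs).ne'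
  have hF' : ∀ s ∈ Set.Icc (0 : ℝ) 1, HasDerivAt
      (fun s => halfBoundA (a s) (b s) * (a₁ - a₀) + halfBoundB (a s) (b s) * (b₁ - b₀))
      ((halfBoundAA (a s) (b s) * (a₁ - a₀) + halfBoundAB (a s) (b s) * (b₁ - b₀)) * (a₁ - a₀) +
        (halfBoundAB (a s) (b s) * (a₁ - a₀) + halfBoundBB (a s) (b s) * (b₁ - b₀)) *
          (b₁ - b₀)) s := fun s hs =>
    ((hasDerivAt_halfBoundA (hda s) (hdb s) (hu s hs).ne').mul_const _).add
      ((hasDerivAt_halfBoundB (hda s) (hdb s) (hu s hs).ne').mul_const _)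
  have hconc : ConcaveOn ℝ (Set.Icc (0 : ℝ) 1) (fun s => halfBound (a s) (b s)) := by
    refine concaveOn_of_hasDerivWithinAt2_nonpos (convex_Icc 0 1)
      (fun s hs => (hF s hs).continuousAt.continuousWithinAt)
      (fun s hs => (hF s (interior_subset hs)).hasDerivWithinAt)
      (fun s hs => (hF' s (interior_subset hs)).hasDerivWithinAt) ?_
    intro s hs
    replace hs := interior_subset hs
    obtain ⟨h1, h2, h3, h4⟩ := hmem s hs
    simp only at h1 h2 h3 h4
    have hus := hu s hs
    have hk : 0 < Real.cos (b s) := Real.cos_pos_of_mem_Ioo ⟨by linarith, by linarith⟩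
    have hk1 : Real.cos (b s) < 1 := by
      rw [← Real.cos_zero]
      exact Real.cos_lt_cos_of_nonneg_of_le_pi_div_two le_rfl (by linarith) (by linarith)
    have hkq : Real.cos (b s) ≤ Real.cos (a s) :=
      Real.cos_le_cos_of_nonneg_of_le_pi (by linarith) (by linarith) h2
    have hsin : 0 < Real.sin (a s) := Real.sin_pos_of_pos_of_lt_pi h1 (by linarith)
    have hk2 : 0 < 1 - Real.cos (b s) ^ 2 := by nlinarith
    have hAA : halfBoundAA (a s) (b s) < 0 := by
      have : 0 < 1 + Real.cos (b s) * Real.cos (a s) - 2 * Real.cos (b s) ^ 2 := by nlinarith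
      unfold halfBoundAA
      rw [neg_lt_zero]
      positivity
    have hdet : 0 ≤ halfBoundAA (a s) (b s) * halfBoundBB (a s) (b s) -
        halfBoundAB (a s) (b s) ^ 2 := by
      rw [halfBound_hessian hus.ne']
      have := cofactorPoly_pos hk hkq (Real.cos_le_one _) hk1
      positivity
    generalize halfBoundAA (a s) (b s) = p at *
    generalize halfBoundAB (a s) (b s) = r at *
    generalize halfBoundBB (a s) (b s) = v at *
    have : 0 ≤ p * ((p * (a₁ - a₀) + r * (b₁ - b₀)) * (a₁ - a₀) +
        (r * (a₁ - a₀) + v * (b₁ - b₀)) * (b₁ - b₀)) := by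
      have e : p * ((p * (a₁ - a₀) + r * (b₁ - b₀)) * (a₁ - a₀) +
        (r * (a₁ - a₀) + v * (b₁ - b₀)) * (b₁ - b₀)) =
        (p * (a₁ - a₀) + r * (b₁ - b₀)) ^ 2 + (p * v - r ^ 2) * (b₁ - b₀) ^ 2 := by ring
      rw [e]; positivity
    exact nonpos_of_mul_nonneg_right this hAA
  have hl' : l = 1 - t := by linarith
  have := hconc.2 (x := 0) (y := 1) (by simp) (by simp) hl ht hlt
  simp only [smul_eq_mul, mul_zero, mul_one, zero_add] at this
  rw [e l t hlt]
  simpa [hadef, hbdef] using this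


/-- Jensen's inequality for `v` on the concavity domain. -/
theorem sum_facialBound_le {f : ℕ} (hf : 0 < f) (τ c : Fin f → ℝ)
    (hmem : ∀ i, (τ i / 2, c i / 2) ∈ concavityDomain) :
    ∑ i, facialBound (τ i) (c i) ≤ f * facialBound ((∑ i, τ i) / f) ((∑ i, c i) / f) := by
  have hf' : (0 : ℝ) < f := by exact_mod_cast hf
  have h := concaveOn_halfBound.le_map_sum (t := Finset.univ) (w := fun _ : Fin f => (1 / f : ℝ))
    (p := fun i => (τ i / 2, c i / 2)) (fun _ _ => by positivity)
    (by simp [hf'.ne']) (fun i _ => hmem i)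
  have e : ∑ i : Fin f, (1 / f : ℝ) • ((τ i / 2, c i / 2) : ℝ × ℝ) =
      ((∑ i, τ i) / f / 2, (∑ i, c i) / f / 2) := by
    rw [Prod.ext_iff, Prod.fst_sum, Prod.snd_sum]
    simp only [Prod.smul_mk, smul_eq_mul, Finset.sum_div]
    constructor <;> exact Finset.sum_congr rfl fun i _ => by ring
  rw [e] at h
  simp only [smul_eq_mul, ← Finset.mul_sum] at h
  simp only [facialBound_eq_halfBound, ← Finset.mul_sum]
  rw [one_div, inv_mul_le_iff₀ hf'] at h
  linarith

/-! ### The volume of a lune -/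

/-- The volume of the unit ball per radian of rotation about an axis. -/
noncomputable def axialMass : ENNReal :=
  ∫⁻ z : ℝ, ∫⁻ r in Set.Ioi (0 : ℝ), ENNReal.ofReal r * {r : ℝ | z ^ 2 + r ^ 2 < 1}.indicator 1 r

/-- In cylindrical coordinates, the part of the unit ball over a set `J` of polar angles has volume
proportional to the length of `J`. -/
theorem volume_sector {Q : ℝ × ℝ → Prop} (hQm : MeasurableSet {p | Q p}) {J : Set ℝ}
    (hJ : MeasurableSet J) (hJsub : J ⊆ Set.Ioo (-Real.pi) Real.pi)
    (hQ : ∀ r > 0, ∀ φ ∈ Set.Ioo (-Real.pi) Real.pi,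
      Q (r * Real.cos φ, r * Real.sin φ) ↔ φ ∈ J) :
    volume {x : ℝ × (ℝ × ℝ) | x.1 ^ 2 + x.2.1 ^ 2 + x.2.2 ^ 2 < 1 ∧ Q x.2} =
      axialMass * volume J := by
  have hJfin : volume J ≠ ⊤ := ne_top_of_le_ne_top (by simp) (measure_mono hJsub)
  have hS : MeasurableSet {x : ℝ × (ℝ × ℝ) | x.1 ^ 2 + x.2.1 ^ 2 + x.2.2 ^ 2 < 1 ∧ Q x.2} := by
    have h1 : MeasurableSet {x : ℝ × (ℝ × ℝ) | x.1 ^ 2 + x.2.1 ^ 2 + x.2.2 ^ 2 < 1} :=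
      measurableSet_lt (by fun_prop) measurable_const
    exact h1.inter (measurable_snd hQm)
  rw [Measure.volume_eq_prod, Measure.prod_apply hS, axialMass, ← lintegral_mul_const' _ _ hJfin]
  refine lintegral_congr fun z => ?_
  have hSz : MeasurableSet (Prod.mk z ⁻¹'
      {x : ℝ × (ℝ × ℝ) | x.1 ^ 2 + x.2.1 ^ 2 + x.2.2 ^ 2 < 1 ∧ Q x.2}) :=
    measurable_prodMk_left hS
  have hg : Measurable ({r : ℝ | z ^ 2 + r ^ 2 < 1}.indicator (1 : ℝ → ENNReal)) :=
    measurable_one.indicator (measurableSet_lt (by fun_prop) measurable_const)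
  rw [← lintegral_indicator_one hSz, ← lintegral_comp_polarCoord_symm, polarCoord_target]
  have hcongr : ∀ p ∈ Set.Ioi (0 : ℝ) ×ˢ Set.Ioo (-Real.pi) Real.pi,
      ENNReal.ofReal p.1 • (Prod.mk z ⁻¹'
        {x : ℝ × (ℝ × ℝ) | x.1 ^ 2 + x.2.1 ^ 2 + x.2.2 ^ 2 < 1 ∧ Q x.2}).indicator
          (1 : ℝ × ℝ → ENNReal) (polarCoord.symm p) =
      (ENNReal.ofReal p.1 * {r : ℝ | z ^ 2 + r ^ 2 < 1}.indicator 1 p.1) *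
        J.indicator 1 p.2 := by
    rintro ⟨r, φ⟩ ⟨hr, hφ⟩
    have h1 : polarCoord.symm (r, φ) = (r * Real.cos φ, r * Real.sin φ) := rfl
    have h2 : z ^ 2 + (r * Real.cos φ) ^ 2 + (r * Real.sin φ) ^ 2 = z ^ 2 + r ^ 2 := by
      linear_combination r ^ 2 * Real.sin_sq_add_cos_sq φ
    have h3 : (r * Real.cos φ, r * Real.sin φ) ∈ (Prod.mk z ⁻¹'
        {x : ℝ × (ℝ × ℝ) | x.1 ^ 2 + x.2.1 ^ 2 + x.2.2 ^ 2 < 1 ∧ Q x.2}) ↔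
        r ∈ {r : ℝ | z ^ 2 + r ^ 2 < 1} ∧ φ ∈ J := by
      rw [← hQ r hr φ hφ, Set.mem_preimage, Set.mem_ofPred_eq, Set.mem_ofPred_eq, h2]
    rw [h1]
    by_cases hA : r ∈ {r : ℝ | z ^ 2 + r ^ 2 < 1}
    · by_cases hB : φ ∈ J
      · rw [Set.indicator_of_mem (h3.2 ⟨hA, hB⟩), Set.indicator_of_mem hA, Set.indicator_of_mem hB]
        simp
      · rw [Set.indicator_of_notMem (fun h => hB (h3.1 h).2), Set.indicator_of_notMem hB]
        simp
    · rw [Set.indicator_of_notMem (fun h => hA (h3.1 h).1), Set.indicator_of_notMem hA]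
      simp
  rw [setLIntegral_congr_fun (measurableSet_Ioi.prod measurableSet_Ioo) hcongr,
    Measure.volume_eq_prod, ← Measure.prod_restrict,
    lintegral_prod_mul (f := fun r => ENNReal.ofReal r * {r : ℝ | z ^ 2 + r ^ 2 < 1}.indicator 1 r)
      (g := J.indicator 1)]
  · rw [lintegral_indicator_one hJ, Measure.restrict_apply hJ, Set.inter_eq_left.2 hJsub]
  · exact (ENNReal.measurable_ofReal.mul hg).aemeasurable
  · exact (measurable_one.indicator hJ).aemeasurable

theorem measurePreserving_cylinder (b : OrthonormalBasis (Fin 3) ℝ E3) :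
    MeasurePreserving (fun x : E3 => ((b.repr x 2, (b.repr x 0, b.repr x 1)) : ℝ × (ℝ × ℝ))) := by
  have h1 := b.measurePreserving_repr
  have h2 := PiLp.volume_preserving_ofLp (Fin 3)
  have h3 := volume_preserving_piFinSuccAbove (fun _ : Fin 3 => ℝ) 2
  have h4 := (MeasurePreserving.id (volume : Measure ℝ)).prod (volume_preserving_finTwoArrow ℝ)
  exact h4.comp (h3.comp (h2.comp h1))

theorem norm_sq_repr (b : OrthonormalBasis (Fin 3) ℝ E3) (x : E3) :
    ‖x‖ ^ 2 = b.repr x 2 ^ 2 + b.repr x 0 ^ 2 + b.repr x 1 ^ 2 := by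
  rw [← b.repr.norm_map x, EuclideanSpace.norm_sq_eq, Fin.sum_univ_three]
  simp only [Real.norm_eq_abs, sq_abs]
  ring

theorem volume_ball_sector (b : OrthonormalBasis (Fin 3) ℝ E3) {Q : ℝ × ℝ → Prop}
    (hQm : MeasurableSet {p | Q p}) {J : Set ℝ}
    (hJ : MeasurableSet J) (hJsub : J ⊆ Set.Ioo (-Real.pi) Real.pi)
    (hQ : ∀ r > 0, ∀ φ ∈ Set.Ioo (-Real.pi) Real.pi,
      Q (r * Real.cos φ, r * Real.sin φ) ↔ φ ∈ J) :
    volume {x : E3 | ‖x‖ < 1 ∧ Q (b.repr x 0, b.repr x 1)} = axialMass * volume J := by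
  have hS : MeasurableSet {x : ℝ × (ℝ × ℝ) | x.1 ^ 2 + x.2.1 ^ 2 + x.2.2 ^ 2 < 1 ∧ Q x.2} := by
    have h1 : MeasurableSet {x : ℝ × (ℝ × ℝ) | x.1 ^ 2 + x.2.1 ^ 2 + x.2.2 ^ 2 < 1} :=
      measurableSet_lt (by fun_prop) measurable_const
    exact h1.inter (measurable_snd hQm)
  rw [← volume_sector hQm hJ hJsub hQ,
    ← (measurePreserving_cylinder b).measure_preimage hS.nullMeasurableSet]
  congr 1
  ext x
  simp only [Set.mem_ofPred_eq, Set.mem_preimage, ← norm_sq_repr b x]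
  rw [sq_lt_one_iff₀ (norm_nonneg x)]

/-- An orthonormal frame whose first two vectors span the plane of `m` and `n`. -/
theorem exists_orthonormalBasis_angle {m n : E3} (hm : m ≠ 0) (hn : n ≠ 0)
    (hsin : 0 < Real.sin (InnerProductGeometry.angle m n)) :
    ∃ b : OrthonormalBasis (Fin 3) ℝ E3, m = ‖m‖ • b 0 ∧
      n = ‖n‖ • (Real.cos (InnerProductGeometry.angle m n) • b 0 +
        Real.sin (InnerProductGeometry.angle m n) • b 1) := by
  set θ := InnerProductGeometry.angle m n with hθ
  have hm' : ‖m‖ ≠ 0 := norm_ne_zero_iff.2 hm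
  have hn' : ‖n‖ ≠ 0 := norm_ne_zero_iff.2 hn
  have hmn : inner ℝ m n = Real.cos θ * (‖m‖ * ‖n‖) :=
    (InnerProductGeometry.cos_angle_mul_norm_mul_norm m n).symm
  have hsq := Real.sin_sq_add_cos_sq θ
  obtain ⟨u, hu⟩ : ∃ u, u = ‖m‖⁻¹ • m := ⟨_, rfl⟩
  obtain ⟨v, hv⟩ : ∃ v, v = ‖n‖⁻¹ • n := ⟨_, rfl⟩
  have huu : inner ℝ u u = (1 : ℝ) := by
    rw [hu, inner_smul_left, inner_smul_right, real_inner_self_eq_norm_sq]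
    simp only [conj_trivial]; field_simp
  have hvv : inner ℝ v v = (1 : ℝ) := by
    rw [hv, inner_smul_left, inner_smul_right, real_inner_self_eq_norm_sq]
    simp only [conj_trivial]; field_simp
  have huv : inner ℝ u v = Real.cos θ := by
    rw [hu, hv, inner_smul_left, inner_smul_right, hmn]
    simp only [conj_trivial]; field_simp
  have hvu : inner ℝ v u = Real.cos θ := by rw [real_inner_comm, huv]
  obtain ⟨w, hw⟩ : ∃ w, w = (Real.sin θ)⁻¹ • (v - Real.cos θ • u) := ⟨_, rfl⟩
  have huw : inner ℝ u w = 0 := by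
    rw [hw, inner_smul_right, inner_sub_right, inner_smul_right, huu, huv]; ring
  have hwu : inner ℝ w u = 0 := by rw [real_inner_comm, huw]
  have hww : inner ℝ w w = (1 : ℝ) := by
    rw [hw]
    simp only [inner_smul_left, inner_smul_right, inner_sub_left, inner_sub_right, huu, hvv, huv,
      hvu, conj_trivial]
    field_simp
    linarith
  have horth : Orthonormal ℝ (({0, 1} : Set (Fin 3)).domRestrict ![u, w, 0]) := by
    rw [orthonormal_iff_ite]
    rintro ⟨i, hi⟩ ⟨j, hj⟩
    rcases hi with rfl | rfl <;> rcases hj with rfl | rfl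
    · exact huu
    · exact huw
    · exact hwu
    · exact hww
  obtain ⟨b, hb⟩ := horth.exists_orthonormalBasis_extension_of_card_eq (by simp)
  have hb0 : b 0 = u := by simpa using hb 0 (by simp)
  have hb1 : b 1 = w := by simpa using hb 1 (by simp)
  refine ⟨b, ?_, ?_⟩
  · rw [hb0, hu, smul_inv_smul₀ hm']
  · rw [hb0, hb1, hw, smul_inv_smul₀ hsin.ne', add_sub_cancel, hv, smul_inv_smul₀ hn']

/-- A lune of the unit ball: the inner normals `m` and `n` of its sides make the angle `π - α`, where
`α` is the opening angle. -/
theorem volume_lune {m n : E3} (hm : m ≠ 0) (hn : n ≠ 0)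
    (hsin : 0 < Real.sin (InnerProductGeometry.angle m n)) :
    volume.real {x : E3 | ‖x‖ < 1 ∧ 0 < inner ℝ m x ∧ 0 < inner ℝ n x} =
      2 / 3 * (Real.pi - InnerProductGeometry.angle m n) := by
  set θ := InnerProductGeometry.angle m n with hθ
  have hθ0 : 0 ≤ θ := InnerProductGeometry.angle_nonneg m n
  have hθπ : θ ≤ Real.pi := InnerProductGeometry.angle_le_pi m n
  have hπ := Real.pi_pos
  have hm' : 0 < ‖m‖ := norm_pos_iff.2 hm
  have hn' : 0 < ‖n‖ := norm_pos_iff.2 hn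
  obtain ⟨b, hbm, hbn⟩ := exists_orthonormalBasis_angle hm hn hsin
  rw [← hθ] at hbn
  have hmx : ∀ x, inner ℝ m x = ‖m‖ * b.repr x 0 := fun x => by
    conv_lhs => rw [hbm]
    rw [b.repr_apply_apply, real_inner_smul_left]
  have hnx : ∀ x, inner ℝ n x = ‖n‖ * (Real.cos θ * b.repr x 0 + Real.sin θ * b.repr x 1) :=
    fun x => by
    conv_lhs => rw [hbn]
    rw [b.repr_apply_apply, b.repr_apply_apply, real_inner_smul_left, inner_add_left,
      real_inner_smul_left, real_inner_smul_left]
  have hQ1 : MeasurableSet {p : ℝ × ℝ | 0 < p.1} := measurableSet_lt measurable_const measurable_fst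
  have hQ2 : MeasurableSet {p : ℝ × ℝ | 0 < Real.cos θ * p.1 + Real.sin θ * p.2} :=
    measurableSet_lt measurable_const (by fun_prop)
  have hlune := volume_ball_sector b (Q := fun p => 0 < p.1 ∧ 0 < Real.cos θ * p.1 + Real.sin θ * p.2)
    (hQ1.inter hQ2)
    (J := Set.Ioo (θ - Real.pi / 2) (Real.pi / 2)) measurableSet_Ioo
    (Set.Ioo_subset_Ioo (by linarith) (by linarith)) (by
      rintro r hr φ ⟨hφ1, hφ2⟩
      have e : Real.cos θ * (r * Real.cos φ) + Real.sin θ * (r * Real.sin φ) =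
          r * Real.cos (φ - θ) := by rw [Real.cos_sub]; ring
      simp only [e, mul_pos_iff_of_pos_left hr, Set.mem_Ioo]
      constructor
      · rintro ⟨h1, h2⟩
        have hlt : φ < Real.pi / 2 := by
          by_contra! h
          have := Real.cos_nonpos_of_pi_div_two_le_of_le h (by linarith)
          linarith
        refine ⟨?_, hlt⟩
        by_contra! h
        have hφ : -(Real.pi / 2) < φ := by
          by_contra! h'
          have := Real.cos_nonpos_of_pi_div_two_le_of_le (x := -φ) (by linarith) (by linarith)
          rw [Real.cos_neg] at this
          linarith
        have := Real.cos_nonpos_of_pi_div_two_le_of_le (x := θ - φ) (by linarith) (by linarith)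
        rw [← Real.cos_neg, neg_sub] at this
        linarith
      · rintro ⟨h1, h2⟩
        exact ⟨Real.cos_pos_of_mem_Ioo ⟨by linarith, by linarith⟩,
          Real.cos_pos_of_mem_Ioo ⟨by linarith, by linarith⟩⟩)
  have hball := volume_ball_sector b (Q := fun _ => True) (by simp)
    (J := Set.Ioo (-Real.pi) Real.pi) measurableSet_Ioo subset_rfl (by simp)
  have e1 : {x : E3 | ‖x‖ < 1 ∧ True} = Metric.ball 0 1 := by ext; simp
  rw [e1, EuclideanSpace.volume_ball_fin_three] at hball
  have e2 : {x : E3 | ‖x‖ < 1 ∧ 0 < inner ℝ m x ∧ 0 < inner ℝ n x} =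
      {x : E3 | ‖x‖ < 1 ∧ 0 < b.repr x 0 ∧
        0 < Real.cos θ * b.repr x 0 + Real.sin θ * b.repr x 1} := by
    ext x
    simp only [Set.mem_ofPred_eq, hmx, hnx, mul_pos_iff_of_pos_left hm', mul_pos_iff_of_pos_left hn']
  have hb2 := congrArg ENNReal.toReal hball
  simp only [Real.volume_Ioo, ENNReal.toReal_mul, ENNReal.ofReal_one, one_pow, one_mul] at hb2
  rw [ENNReal.toReal_ofReal (by positivity), ENNReal.toReal_ofReal (by linarith)] at hb2
  rw [e2, Measure.real, hlune, Real.volume_Ioo, ENNReal.toReal_mul,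
    ENNReal.toReal_ofReal (by linarith)]
  have : axialMass.toReal = 2 / 3 := by
    have : Real.pi * (axialMass.toReal * 2) = Real.pi * (4 / 3) := by linarith
    have := mul_left_cancel₀ hπ.ne' this
    linarith
  rw [this]; ring

/-! ### Girard's theorem -/

theorem ae_inner_ne_zero {n : E3} (hn : n ≠ 0) :
    ∀ᵐ x ∂(volume : Measure E3), inner ℝ n x ≠ 0 := by
  have h := Measure.addHaar_submodule (volume : Measure E3) (ℝ ∙ n)ᗮ (by
    intro h
    have h1 : n ∈ (ℝ ∙ n)ᗮ := by rw [h]; trivial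
    rw [Submodule.mem_orthogonal_singleton_iff_inner_right] at h1
    exact hn (inner_self_eq_zero.1 h1))
  rw [ae_iff]
  refine measure_mono_null ?_ h
  intro x hx
  rw [Set.mem_ofPred_eq, not_not] at hx
  exact (Submodule.mem_orthogonal_singleton_iff_inner_right).2 hx

theorem measurableSet_inner_pos (n : E3) : MeasurableSet {x : E3 | 0 < inner ℝ n x} :=
  measurableSet_lt measurable_const (by fun_prop)

theorem measureReal_ball_neg {S T : Set E3}
    (hT : MeasurableSet T) (h : ∀ᵐ x ∂(volume : Measure E3), x ∈ S ↔ -x ∈ T) :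
    (volume.restrict (Metric.ball (0 : E3) 1)).real S =
      (volume.restrict (Metric.ball (0 : E3) 1)).real T := by
  have h1 : MeasurePreserving (fun x : E3 => -x) (volume.restrict (Metric.ball (0 : E3) 1))
      (volume.restrict (Metric.ball (0 : E3) 1)) := by
    have h2 := (Measure.measurePreserving_neg (volume : Measure E3)).restrict_preimage
      (Metric.isOpen_ball (x := (0 : E3)) (ε := 1)).measurableSet
    have h3 : (Neg.neg : E3 → E3) ⁻¹' Metric.ball (0 : E3) 1 = Metric.ball (0 : E3) 1 := by
      ext x; simp
    rwa [h3] at h2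
  rw [Measure.real, Measure.real, ← h1.measure_preimage hT.nullMeasurableSet]
  congr 1
  exact measure_congr (Filter.eventuallyEq_set.2 (ae_restrict_of_ae h))

/-- Girard's theorem in terms of the inner normals of the three faces of a trihedral cone. It follows
from `volume_lune` by inclusion and exclusion, since the complement of the union of the three half
spaces is, up to a null set, antipodal to their intersection. -/
theorem volume_trihedron {l m n : E3} (hl : l ≠ 0) (hm : m ≠ 0) (hn : n ≠ 0)
    (hlm : 0 < Real.sin (InnerProductGeometry.angle l m))
    (hmn : 0 < Real.sin (InnerProductGeometry.angle m n))
    (hnl : 0 < Real.sin (InnerProductGeometry.angle n l)) :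
    volume.real {x : E3 | ‖x‖ < 1 ∧ 0 < inner ℝ l x ∧ 0 < inner ℝ m x ∧ 0 < inner ℝ n x} =
      (2 * Real.pi - (InnerProductGeometry.angle l m + InnerProductGeometry.angle m n +
        InnerProductGeometry.angle n l)) / 3 := by
  obtain ⟨ν, hν⟩ : ∃ ν, ν = volume.restrict (Metric.ball (0 : E3) 1) := ⟨_, rfl⟩
  have hfin : IsFiniteMeasure ν := ⟨by rw [hν, Measure.restrict_apply_univ]; exact measure_ball_lt_top⟩
  set H : E3 → Set E3 := fun n => {x : E3 | 0 < inner ℝ n x} with hH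
  have hmeas : ∀ n, MeasurableSet (H n) := measurableSet_inner_pos
  have hmemH : ∀ n x, x ∈ H n ↔ 0 < inner ℝ n x := fun n x => Iff.rfl
  have hνS : ∀ S, MeasurableSet S → ν.real S = volume.real (S ∩ Metric.ball (0 : E3) 1) :=
    fun S hS => by rw [hν, measureReal_restrict_apply hS]
  have hcompl : ∀ n : E3, n ≠ 0 → ∀ᵐ x ∂(volume : Measure E3), x ∈ (H n)ᶜ ↔ -x ∈ H n := by
    intro n hn
    filter_upwards [ae_inner_ne_zero hn] with x hx
    rw [Set.mem_compl_iff, hmemH, hmemH, inner_neg_right, not_lt, Left.neg_pos_iff]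
    exact ⟨fun h => lt_of_le_of_ne h hx, le_of_lt⟩
  have hV : ν.real Set.univ = 4 / 3 * Real.pi := by
    rw [hνS _ MeasurableSet.univ, Set.univ_inter, Measure.real,
      EuclideanSpace.volume_ball_fin_three, ENNReal.ofReal_one, one_pow, one_mul,
      ENNReal.toReal_ofReal (by positivity)]
    ring
  have hhalf : ∀ n : E3, n ≠ 0 → ν.real (H n) = 2 / 3 * Real.pi ∧
      ν.real (H n)ᶜ = 2 / 3 * Real.pi := by
    intro n hn
    have h1 : ν.real (H n)ᶜ = ν.real (H n) := by
      rw [hν]; exact measureReal_ball_neg (hmeas n) (hcompl n hn)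
    have h2 := measureReal_add_measureReal_compl (μ := ν) (hmeas n)
    constructor <;> linarith
  have hlune : ∀ m n : E3, m ≠ 0 → n ≠ 0 → 0 < Real.sin (InnerProductGeometry.angle m n) →
      ν.real (H m ∩ H n) = 2 / 3 * (Real.pi - InnerProductGeometry.angle m n) := by
    intro m n hm hn h
    rw [hνS _ ((hmeas m).inter (hmeas n)), ← volume_lune hm hn h]
    congr 1
    ext x
    simp only [Set.mem_inter_iff, hmemH, mem_ball_zero_iff, Set.mem_ofPred_eq]
    tauto
  have hT : volume.real {x : E3 | ‖x‖ < 1 ∧ 0 < inner ℝ l x ∧ 0 < inner ℝ m x ∧ 0 < inner ℝ n x} =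
      ν.real (H l ∩ H m ∩ H n) := by
    rw [hνS _ (((hmeas l).inter (hmeas m)).inter (hmeas n))]
    congr 1
    ext x
    simp only [Set.mem_inter_iff, hmemH, mem_ball_zero_iff, Set.mem_ofPred_eq]
    tauto
  have hanti : ν.real ((H l)ᶜ ∩ (H m)ᶜ ∩ (H n)ᶜ) = ν.real (H l ∩ H m ∩ H n) := by
    rw [hν]
    refine measureReal_ball_neg (((hmeas l).inter (hmeas m)).inter (hmeas n)) ?_
    filter_upwards [hcompl l hl, hcompl m hm, hcompl n hn] with x h1 h2 h3
    simp only [Set.mem_inter_iff, h1, h2, h3]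
  have split : ∀ S : Set E3, ∀ n, ν.real (S ∩ H n) + ν.real (S ∩ (H n)ᶜ) = ν.real S := by
    intro S n
    rw [← Set.sdiff_eq]
    exact measureReal_inter_add_sdiff (hmeas n)
  have s1 := split ((H l)ᶜ ∩ (H m)ᶜ) n
  have s2 := split (H n ∩ (H l)ᶜ) m
  have s3 := split (H n) l
  have s4 := split (H m ∩ H n) l
  have s5 := split (H l)ᶜ m
  have s6 := split (H m) l
  rw [show (H l)ᶜ ∩ (H m)ᶜ ∩ H n = H n ∩ (H l)ᶜ ∩ (H m)ᶜ by ext; simp only [Set.mem_inter_iff]; tauto]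
    at s1
  rw [show H n ∩ (H l)ᶜ ∩ H m = H m ∩ H n ∩ (H l)ᶜ by ext; simp only [Set.mem_inter_iff]; tauto]
    at s2
  rw [show H m ∩ H n ∩ H l = H l ∩ H m ∩ H n by ext; simp only [Set.mem_inter_iff]; tauto] at s4
  rw [show (H l)ᶜ ∩ H m = H m ∩ (H l)ᶜ from Set.inter_comm _ _] at s5
  rw [Set.inter_comm (H m) (H l)] at s6
  rw [hT]
  have a1 := hlune l m hl hm hlm
  have a2 := hlune m n hm hn hmn
  have a3 := hlune n l hn hl hnl
  have b1 := hhalf l hl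
  have b2 := hhalf m hm
  have b3 := hhalf n hn
  linarith [b1.1, b1.2, b2.1, b2.2, b3.1, b3.2]

/-- Spherical area of the trace of a cone, as a volume inside the unit ball. -/
theorem toSphere_real_cone {K : Set E3} (hK : MeasurableSet K)
    (hcone : ∀ r : ℝ, 0 < r → ∀ x ∈ K, r • x ∈ K) :
    (volume : Measure E3).toSphere.real {u : Metric.sphere (0 : E3) 1 | (u : E3) ∈ K} =
      3 * volume.real (Metric.ball (0 : E3) 1 ∩ K) := by
  have hm : MeasurableSet {u : Metric.sphere (0 : E3) 1 | (u : E3) ∈ K} := measurable_subtype_coe hK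
  have e : Set.Ioo (0 : ℝ) 1 • (Subtype.val '' {u : Metric.sphere (0 : E3) 1 | (u : E3) ∈ K}) =
      (Metric.ball (0 : E3) 1 ∩ K) \ {0} := by
    ext x
    rw [Set.mem_smul]
    constructor
    · rintro ⟨r, ⟨hr0, hr1⟩, _, ⟨u, hu, rfl⟩, rfl⟩
      have hu1 : ‖(u : E3)‖ = 1 := by simp
      refine ⟨⟨?_, hcone r hr0 _ hu⟩, ?_⟩
      · rw [mem_ball_zero_iff, norm_smul, hu1, Real.norm_of_nonneg hr0.le, mul_one]
        exact hr1
      · rw [Set.mem_singleton_iff, smul_eq_zero, not_or]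
        exact ⟨hr0.ne', norm_ne_zero_iff.1 (by rw [hu1]; exact one_ne_zero)⟩
    · rintro ⟨⟨hx1, hxK⟩, hx0⟩
      rw [Set.mem_singleton_iff] at hx0
      have hxn : 0 < ‖x‖ := norm_pos_iff.2 hx0
      refine ⟨‖x‖, ⟨hxn, mem_ball_zero_iff.1 hx1⟩, ‖x‖⁻¹ • x, ⟨⟨‖x‖⁻¹ • x, ?_⟩, ?_, rfl⟩, ?_⟩
      · rw [mem_sphere_zero_iff_norm, norm_smul, norm_inv, norm_norm, inv_mul_cancel₀ hxn.ne']
      · exact hcone _ (inv_pos.2 hxn) _ hxK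
      · exact smul_inv_smul₀ hxn.ne' x
  rw [Measure.real, Measure.toSphere_apply' _ hm, e, measure_sdiff_null (by simp)]
  simp [Measure.real]

/-- The vector product in `E3`. -/
noncomputable def cross (x y : E3) : E3 :=
  !₂[x 1 * y 2 - x 2 * y 1, x 2 * y 0 - x 0 * y 2, x 0 * y 1 - x 1 * y 0]

/-- The determinant of three vectors of `E3`. -/
noncomputable def triple (x y z : E3) : ℝ :=
  x 0 * (y 1 * z 2 - y 2 * z 1) + x 1 * (y 2 * z 0 - y 0 * z 2) + x 2 * (y 0 * z 1 - y 1 * z 0)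

theorem inner_eq_coords (x y : E3) : inner ℝ x y = x 0 * y 0 + x 1 * y 1 + x 2 * y 2 := by
  simp [PiLp.inner_apply, Fin.sum_univ_three, mul_comm]

theorem inner_cross (x y z : E3) : inner ℝ (cross y z) x = triple x y z := by
  simp [inner_eq_coords, cross, triple]; ring

theorem inner_cross_cross (x y z w : E3) : inner ℝ (cross x y) (cross z w) =
    inner ℝ x z * inner ℝ y w - inner ℝ x w * inner ℝ y z := by
  simp [inner_eq_coords, cross]; ring

theorem triple_sq (x y z : E3) : triple x y z ^ 2 =
    inner ℝ x x * inner ℝ y y * inner ℝ z z + 2 * inner ℝ y z * inner ℝ z x * inner ℝ x y -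
      inner ℝ x x * inner ℝ y z ^ 2 - inner ℝ y y * inner ℝ z x ^ 2 -
        inner ℝ z z * inner ℝ x y ^ 2 := by
  simp only [inner_eq_coords, triple]; ring

theorem cramer (A B C x : E3) : triple A B C • x =
    triple x B C • A + triple x C A • B + triple x A B • C := by
  ext i
  fin_cases i <;> simp [triple] <;> ring

theorem triple_comb (A B C : E3) (a b c : ℝ) :
    triple (a • A + b • B + c • C) B C = a * triple A B C := by
  simp [triple]; ring

theorem triple_rotate (A B C : E3) : triple B C A = triple A B C := by
  simp [triple]; ring

theorem triple_swap (A B C : E3) : triple B A C = -triple A B C := by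
  simp [triple]; ring

theorem convexHull_triple {A B C : E3} (hAB : A ≠ B) (hAC : A ≠ C) (hBC : B ≠ C) (x : E3) :
    x ∈ convexHull ℝ ({A, B, C} : Set E3) ↔
      ∃ a b c : ℝ, 0 ≤ a ∧ 0 ≤ b ∧ 0 ≤ c ∧ a + b + c = 1 ∧ a • A + b • B + c • C = x := by
  classical
  have e : ({A, B, C} : Set E3) = (({A, B, C} : Finset E3) : Set E3) := by simp
  constructor
  · rw [e, Finset.mem_convexHull']
    rintro ⟨w, hw, hw1, hx⟩
    rw [Finset.sum_insert (by simp [hAB, hAC]), Finset.sum_insert (by simp [hBC]),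
      Finset.sum_singleton, ← add_assoc] at hw1 hx
    exact ⟨w A, w B, w C, hw A (by simp), hw B (by simp), hw C (by simp), hw1, hx⟩
  · rintro ⟨a, b, c, ha, hb, hc, habc, rfl⟩
    have hA := subset_convexHull ℝ ({A, B, C} : Set E3) (show A ∈ ({A, B, C} : Set E3) by simp)
    have hB := subset_convexHull ℝ ({A, B, C} : Set E3) (show B ∈ ({A, B, C} : Set E3) by simp)
    have hC := subset_convexHull ℝ ({A, B, C} : Set E3) (show C ∈ ({A, B, C} : Set E3) by simp)
    have := (convex_convexHull ℝ ({A, B, C} : Set E3)).sum_mem (t := Finset.univ)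
      (w := ![a, b, c]) (z := ![A, B, C])
      (by intro i _; fin_cases i <;> simp [ha, hb, hc])
      (by simp [Fin.sum_univ_three, habc])
      (by intro i _; fin_cases i <;> simp [hA, hB, hC])
    simpa [Fin.sum_univ_three] using this

theorem ne_of_triple_ne_zero {A B C : E3} (h : triple A B C ≠ 0) : A ≠ B ∧ A ≠ C ∧ B ≠ C := by
  refine ⟨?_, ?_, ?_⟩ <;> rintro rfl <;> apply h <;> simp only [triple] <;> ring

/-- The central projection of a positively oriented triangle is cut out by the planes through the
centre and its sides. -/
theorem exists_smul_mem_convexHull_iff {A B C : E3} (hD : 0 < triple A B C) {x : E3} (hx : x ≠ 0) :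
    (∃ r : ℝ, 0 < r ∧ r • x ∈ convexHull ℝ ({A, B, C} : Set E3)) ↔
      0 ≤ inner ℝ (cross B C) x ∧ 0 ≤ inner ℝ (cross C A) x ∧ 0 ≤ inner ℝ (cross A B) x := by
  obtain ⟨hAB, hAC, hBC⟩ := ne_of_triple_ne_zero hD.ne'
  simp only [inner_cross, convexHull_triple hAB hAC hBC]
  have hsm : ∀ (r : ℝ) y z, triple (r • x) y z = r * triple x y z := by
    intro r y z; simp [triple]; ring
  constructor
  · rintro ⟨r, hr, a, b, c, ha, hb, hc, -, h⟩
    have e1 := triple_comb A B C a b c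
    have e2 := triple_comb B C A b c a
    have e3 := triple_comb C A B c a b
    rw [h, hsm] at e1
    rw [show b • B + c • C + a • A = r • x by rw [← h]; abel, hsm, triple_rotate A B C] at e2
    rw [show c • C + a • A + b • B = r • x by rw [← h]; abel, hsm, ← triple_rotate C A B] at e3
    refine ⟨?_, ?_, ?_⟩
    · exact nonneg_of_mul_nonneg_right (by rw [e1]; positivity) hr
    · exact nonneg_of_mul_nonneg_right (by rw [e2]; positivity) hr
    · exact nonneg_of_mul_nonneg_right (by rw [e3]; positivity) hr
  · rintro ⟨h1, h2, h3⟩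
    have hc := cramer A B C x
    set s := triple x B C + triple x C A + triple x A B with hs
    have hs0 : 0 < s := by
      refine lt_of_le_of_ne (by positivity) ?_
      intro h0
      have z1 : triple x B C = 0 := by linarith
      have z2 : triple x C A = 0 := by linarith
      have z3 : triple x A B = 0 := by linarith
      rw [z1, z2, z3] at hc
      simp only [zero_smul, add_zero, smul_eq_zero] at hc
      rcases hc with h | h
      · exact hD.ne' h
      · exact hx h
    refine ⟨triple A B C / s, by positivity, triple x B C / s, triple x C A / s,
      triple x A B / s, by positivity, by positivity, by positivity, ?_, ?_⟩
    · rw [← add_div, ← add_div, ← hs, div_self hs0.ne']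
    · have : s⁻¹ • (triple A B C • x) = (triple A B C / s) • x := by
        rw [smul_smul, inv_mul_eq_div]
      rw [← this, hc, smul_add, smul_add]
      simp only [smul_smul, inv_mul_eq_div]

/-- Girard's theorem for the central projection of a triangle. -/
theorem sphericalArea_triangle {A B C : E3} (hD : 0 < triple A B C)
    (h1 : 0 < Real.sin (InnerProductGeometry.angle (cross B C) (cross C A)))
    (h2 : 0 < Real.sin (InnerProductGeometry.angle (cross C A) (cross A B)))
    (h3 : 0 < Real.sin (InnerProductGeometry.angle (cross A B) (cross B C))) :
    sphericalArea (convexHull ℝ ({A, B, C} : Set E3)) =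
      2 * Real.pi - (InnerProductGeometry.angle (cross B C) (cross C A) +
        InnerProductGeometry.angle (cross C A) (cross A B) +
        InnerProductGeometry.angle (cross A B) (cross B C)) := by
  have hn : ∀ {y z x : E3}, triple x y z ≠ 0 → cross y z ≠ 0 := by
    intro y z x h h0
    rw [← inner_cross, h0, inner_zero_left] at h
    exact h rfl
  have n1 : cross B C ≠ 0 := hn hD.ne'
  have n2 : cross C A ≠ 0 := hn (x := B) (by rw [triple_rotate]; exact hD.ne')
  have n3 : cross A B ≠ 0 := hn (x := C) (by rw [← triple_rotate]; exact hD.ne')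
  set K : Set E3 := {x | 0 ≤ inner ℝ (cross B C) x ∧ 0 ≤ inner ℝ (cross C A) x ∧
    0 ≤ inner ℝ (cross A B) x} with hK
  have hKmem : ∀ x, x ∈ K ↔ 0 ≤ inner ℝ (cross B C) x ∧ 0 ≤ inner ℝ (cross C A) x ∧
    0 ≤ inner ℝ (cross A B) x := fun x => Iff.rfl
  have hclosed : ∀ n : E3, MeasurableSet {x : E3 | 0 ≤ inner ℝ n x} := fun n =>
    measurableSet_le measurable_const (by fun_prop)
  have hKm : MeasurableSet K := (hclosed _).inter ((hclosed _).inter (hclosed _))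
  have hcone : ∀ r : ℝ, 0 < r → ∀ x ∈ K, r • x ∈ K := by
    intro r hr x hx
    rw [hKmem] at hx ⊢
    simp only [inner_smul_right]
    exact ⟨mul_nonneg hr.le hx.1, mul_nonneg hr.le hx.2.1, mul_nonneg hr.le hx.2.2⟩
  have hproj : centralProjection (convexHull ℝ ({A, B, C} : Set E3)) =
      {u : Metric.sphere (0 : E3) 1 | (u : E3) ∈ K} := by
    ext u
    have hu : (u : E3) ≠ 0 := norm_ne_zero_iff.1 (by simp)
    exact exists_smul_mem_convexHull_iff hD hu
  rw [sphericalArea, hproj, toSphere_real_cone hKm hcone]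
  have hgir := volume_trihedron n1 n2 n3 h1 h2 h3
  have : volume.real (Metric.ball (0 : E3) 1 ∩ K) = volume.real {x : E3 | ‖x‖ < 1 ∧
      0 < inner ℝ (cross B C) x ∧ 0 < inner ℝ (cross C A) x ∧ 0 < inner ℝ (cross A B) x} := by
    refine measureReal_congr (Filter.eventuallyEq_set.2 ?_)
    filter_upwards [ae_inner_ne_zero n1, ae_inner_ne_zero n2, ae_inner_ne_zero n3] with x g1 g2 g3
    rw [Set.mem_inter_iff, hKmem, mem_ball_zero_iff]
    rw [lt_iff_le_and_ne (b := inner ℝ (cross B C) x), lt_iff_le_and_ne (b := inner ℝ (cross C A) x),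
      lt_iff_le_and_ne (b := inner ℝ (cross A B) x)]
    have := g1.symm
    have := g2.symm
    have := g3.symm
    tauto
  rw [this, hgir]
  ring

/-! ### The tetrahedron over a spherical triangle -/

theorem cos_sin_angle_cross {A B C : E3} (hC : ‖C‖ = 1) (hD : 0 ≤ triple A B C) :
    Real.cos (InnerProductGeometry.angle (cross B C) (cross C A)) *
        (‖cross B C‖ * ‖cross C A‖) = inner ℝ B C * inner ℝ C A - inner ℝ A B ∧
      Real.sin (InnerProductGeometry.angle (cross B C) (cross C A)) *
        (‖cross B C‖ * ‖cross C A‖) = triple A B C := by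
  have hCC : inner ℝ C C = (1 : ℝ) := by rw [real_inner_self_eq_norm_sq, hC, one_pow]
  constructor
  · rw [InnerProductGeometry.cos_angle_mul_norm_mul_norm, inner_cross_cross, hCC,
      real_inner_comm A B, mul_one]
  · rw [InnerProductGeometry.sin_angle_mul_norm_mul_norm, inner_cross_cross, inner_cross_cross,
      inner_cross_cross, hCC, ← Real.sqrt_sq hD, triple_sq, hCC, real_inner_comm C B,
      real_inner_comm C A, real_inner_comm A B]
    congr 1
    ring

/-- The product of the complex numbers `(xy - z) + iD`, `(yz - x) + iD`, `(zx - y) + iD`, whose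
arguments are the angles between the face normals, equals `(1 + x + y + z - iD)²` times a positive
factor; real and imaginary part of this identity. -/
theorem trihedral_product_identity {a b c x y z D C₁ C₂ C₃ S₁ S₂ S₃ : ℝ}
    (ha : a ^ 2 = 1 - x ^ 2) (hb : b ^ 2 = 1 - y ^ 2) (hc : c ^ 2 = 1 - z ^ 2)
    (c₁ : C₁ * (a * b) = x * y - z) (s₁ : S₁ * (a * b) = D)
    (c₂ : C₂ * (b * c) = y * z - x) (s₂ : S₂ * (b * c) = D)
    (c₃ : C₃ * (c * a) = z * x - y) (s₃ : S₃ * (c * a) = D)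
    (hD : D ^ 2 = 1 + 2 * x * y * z - x ^ 2 - y ^ 2 - z ^ 2) :
    2 * ((1 - x ^ 2) * (1 - y ^ 2) * (1 - z ^ 2)) *
      ((C₁ * C₂ - S₁ * S₂) * C₃ - (S₁ * C₂ + C₁ * S₂) * S₃) =
      ((1 + x + y + z) ^ 2 - D ^ 2) * ((1 - x) * (1 - y) * (1 - z)) ∧
    2 * ((1 - x ^ 2) * (1 - y ^ 2) * (1 - z ^ 2)) *
      -((S₁ * C₂ + C₁ * S₂) * C₃ + (C₁ * C₂ - S₁ * S₂) * S₃) =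
      2 * (1 + x + y + z) * D * ((1 - x) * (1 - y) * (1 - z)) := by
  constructor
  · have e : 2 * ((1 - x ^ 2) * (1 - y ^ 2) * (1 - z ^ 2)) *
        ((C₁ * C₂ - S₁ * S₂) * C₃ - (S₁ * C₂ + C₁ * S₂) * S₃) =
        2 * (((C₁ * (a * b)) * (C₂ * (b * c)) - (S₁ * (a * b)) * (S₂ * (b * c))) *
          (C₃ * (c * a)) - ((S₁ * (a * b)) * (C₂ * (b * c)) + (C₁ * (a * b)) * (S₂ * (b * c))) *
          (S₃ * (c * a))) := by
      rw [← ha, ← hb, ← hc]; ring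
    rw [e, c₁, c₂, c₃, s₁, s₂, s₃]
    linear_combination ((1 - x) * (1 - y) * (1 - z) - 2 * (x * y - z + (y * z - x) + (z * x - y)))
      * hD
  · have e : 2 * ((1 - x ^ 2) * (1 - y ^ 2) * (1 - z ^ 2)) *
        -((S₁ * C₂ + C₁ * S₂) * C₃ + (C₁ * C₂ - S₁ * S₂) * S₃) =
        2 * -(((S₁ * (a * b)) * (C₂ * (b * c)) + (C₁ * (a * b)) * (S₂ * (b * c))) *
          (C₃ * (c * a)) + ((C₁ * (a * b)) * (C₂ * (b * c)) - (S₁ * (a * b)) * (S₂ * (b * c))) *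
          (S₃ * (c * a))) := by
      rw [← ha, ← hb, ← hc]; ring
    rw [e, c₁, c₂, c₃, s₁, s₂, s₃]
    linear_combination 2 * D * hD

/-- The half area of a spherical triangle with side cosines `x`, `y`, `z` is the argument of
`(1 + x + y + z) + iD`. -/
theorem sphericalArea_cos_sin {A B C : E3} (hA : ‖A‖ = 1) (hB : ‖B‖ = 1) (hC : ‖C‖ = 1)
    (hD : 0 < triple A B C) {x y z : ℝ} (hx : x = inner ℝ B C) (hy : y = inner ℝ C A)
    (hz : z = inner ℝ A B) :
    0 < 1 + x ∧ 0 < 1 + y ∧ 0 < 1 + z ∧ 0 < 1 - z ∧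
    (1 + x + y + z) ^ 2 + triple A B C ^ 2 = 2 * (1 + x) * (1 + y) * (1 + z) ∧
    Real.cos (sphericalArea (convexHull ℝ ({A, B, C} : Set E3))) *
      (2 * (1 + x) * (1 + y) * (1 + z)) = (1 + x + y + z) ^ 2 - triple A B C ^ 2 ∧
    Real.sin (sphericalArea (convexHull ℝ ({A, B, C} : Set E3))) *
      (2 * (1 + x) * (1 + y) * (1 + z)) = 2 * (1 + x + y + z) * triple A B C := by
  have hAA : inner ℝ A A = (1 : ℝ) := by rw [real_inner_self_eq_norm_sq, hA, one_pow]
  have hBB : inner ℝ B B = (1 : ℝ) := by rw [real_inner_self_eq_norm_sq, hB, one_pow]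
  have hCC : inner ℝ C C = (1 : ℝ) := by rw [real_inner_self_eq_norm_sq, hC, one_pow]
  have hD2 : triple B C A = triple A B C := triple_rotate A B C
  have hD3 : triple C A B = triple A B C := (triple_rotate C A B).symm
  obtain ⟨c1, s1⟩ := cos_sin_angle_cross hC hD.le
  obtain ⟨c2, s2⟩ := cos_sin_angle_cross (A := B) (B := C) (C := A) hA (by rw [hD2]; exact hD.le)
  obtain ⟨c3, s3⟩ := cos_sin_angle_cross (A := C) (B := A) (C := B) hB (by rw [hD3]; exact hD.le)
  rw [hD2] at s2
  rw [hD3] at s3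
  have hgram := triple_sq A B C
  have q1 : ‖cross B C‖ ^ 2 = 1 - x ^ 2 := by
    rw [← real_inner_self_eq_norm_sq, inner_cross_cross, hBB, hCC, real_inner_comm B C, hx]; ring
  have q2 : ‖cross C A‖ ^ 2 = 1 - y ^ 2 := by
    rw [← real_inner_self_eq_norm_sq, inner_cross_cross, hAA, hCC, real_inner_comm C A, hy]; ring
  have q3 : ‖cross A B‖ ^ 2 = 1 - z ^ 2 := by
    rw [← real_inner_self_eq_norm_sq, inner_cross_cross, hAA, hBB, real_inner_comm A B, hz]; ring
  rw [hAA, hBB, hCC, ← hx, ← hy, ← hz] at hgram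
  rw [← hx, ← hy, ← hz] at c1 c2 c3
  have hpos : ∀ s p : ℝ, s * p = triple A B C → 0 ≤ p → 0 < p ∧ 0 < s := by
    intro s p h hp
    have hp' : 0 < p := lt_of_le_of_ne hp (by rintro rfl; rw [mul_zero] at h; exact hD.ne h)
    exact ⟨hp', pos_of_mul_pos_left (by rw [h]; exact hD) hp⟩
  have r1 := hpos _ _ s1 (by positivity)
  have r2 := hpos _ _ s2 (by positivity)
  have r3 := hpos _ _ s3 (by positivity)
  have harea := sphericalArea_triangle hD r1.2 r2.2 r3.2
  have m1 : 0 < ‖cross B C‖ := pos_of_mul_pos_left r1.1 (norm_nonneg _)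
  have m2 : 0 < ‖cross C A‖ := pos_of_mul_pos_right r1.1 (norm_nonneg _)
  have m3 : 0 < ‖cross A B‖ := pos_of_mul_pos_right r2.1 (norm_nonneg _)
  have hx2 : 0 < 1 - x ^ 2 := by rw [← q1]; positivity
  have hy2 : 0 < 1 - y ^ 2 := by rw [← q2]; positivity
  have hz2 : 0 < 1 - z ^ 2 := by rw [← q3]; positivity
  have hx3 := abs_lt.1 ((sq_lt_one_iff_abs_lt_one x).1 (by linarith))
  have hy3 := abs_lt.1 ((sq_lt_one_iff_abs_lt_one y).1 (by linarith))
  have hz3 := abs_lt.1 ((sq_lt_one_iff_abs_lt_one z).1 (by linarith))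
  have hE : (1 - x) * (1 - y) * (1 - z) ≠ 0 := by
    have : 0 < 1 - x := by linarith
    have : 0 < 1 - y := by linarith
    have : 0 < 1 - z := by linarith
    positivity
  have hgram' : triple A B C ^ 2 = 1 + 2 * x * y * z - x ^ 2 - y ^ 2 - z ^ 2 := by
    rw [hgram]; ring
  have key := trihedral_product_identity q1 q2 q3 c1 s1 c2 s2 c3 s3 hgram'
  refine ⟨by linarith, by linarith, by linarith, by linarith, by rw [hgram]; ring, ?_, ?_⟩
  · refine mul_right_cancel₀ hE ?_
    rw [harea, Real.cos_two_pi_sub, Real.cos_add, Real.cos_add, Real.sin_add, ← key.1]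
    ring
  · refine mul_right_cancel₀ hE ?_
    rw [harea, Real.sin_two_pi_sub, Real.sin_add, Real.cos_add, Real.sin_add, ← key.2]
    ring

/-- Among the spherical triangles with a given side `c` and area `τ` the isosceles one spans the
largest tetrahedron with the centre; its volume is `v(τ, c)`. -/
theorem triple_le_facialBound {A B C : E3} (hA : ‖A‖ = 1) (hB : ‖B‖ = 1) (hC : ‖C‖ = 1)
    (hD : 0 < triple A B C) {τ : ℝ} (hτ : τ = sphericalArea (convexHull ℝ ({A, B, C} : Set E3)))
    (hτ0 : 0 < τ) (hτ1 : τ < Real.pi / 2) :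
    triple A B C / 6 ≤ facialBound τ (InnerProductGeometry.angle A B) := by
  obtain ⟨x, hx⟩ : ∃ x, x = inner ℝ B C := ⟨_, rfl⟩
  obtain ⟨y, hy⟩ : ∃ y, y = inner ℝ C A := ⟨_, rfl⟩
  obtain ⟨z, hz⟩ : ∃ z, z = inner ℝ A B := ⟨_, rfl⟩
  obtain ⟨hx1, hy1, hz1, hz2, hN, hcos, hsin⟩ := sphericalArea_cos_sin hA hB hC hD hx hy hz
  rw [← hτ] at hcos hsin
  set c := InnerProductGeometry.angle A B with hc
  have hzc : Real.cos c = z := by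
    have := InnerProductGeometry.cos_angle_mul_norm_mul_norm A B
    rw [hA, hB, mul_one, mul_one, ← hz] at this
    exact this
  have hc0 : 0 ≤ c := InnerProductGeometry.angle_nonneg A B
  have hcπ : c ≤ Real.pi := InnerProductGeometry.angle_le_pi A B
  have hcπ' : c < Real.pi := lt_of_le_of_ne hcπ (by
    intro h; rw [h, Real.cos_pi] at hzc; linarith)
  have hc0' : 0 < c := lt_of_le_of_ne hc0 (by
    intro h; rw [← h, Real.cos_zero] at hzc; linarith)
  have hu := one_sub_cos_mul_cos_pos (a := τ / 2) (b := c / 2) (by linarith) (by linarith)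
  have hk0 : 0 < Real.cos (c / 2) := Real.cos_pos_of_mem_Ioo ⟨by linarith, by linarith⟩
  have hs0 : 0 < Real.sin (c / 2) := Real.sin_pos_of_pos_of_lt_pi (by linarith) (by linarith)
  have hq0 : 0 < Real.cos (τ / 2) := Real.cos_pos_of_mem_Ioo ⟨by linarith, by linarith⟩
  have ht0 : 0 < Real.sin (τ / 2) := Real.sin_pos_of_pos_of_lt_pi (by linarith) (by linarith)
  have hsτ : 0 < Real.sin τ := Real.sin_pos_of_pos_of_lt_pi (by linarith) (by linarith)
  have hk2 : 2 * Real.cos (c / 2) ^ 2 = 1 + z := by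
    have : Real.cos c = 2 * Real.cos (c / 2) ^ 2 - 1 := by rw [← Real.cos_two_mul]; ring_nf
    linarith
  have hq2 : 2 * Real.cos (τ / 2) ^ 2 = 1 + Real.cos τ := by
    have : Real.cos τ = 2 * Real.cos (τ / 2) ^ 2 - 1 := by rw [← Real.cos_two_mul]; ring_nf
    linarith
  have hks := Real.sin_sq_add_cos_sq (c / 2)
  have hqt := Real.sin_sq_add_cos_sq (τ / 2)
  rw [facialBound_eq_halfBound, halfBound]
  set D := triple A B C with hDdef
  have hp : 0 < 1 + x + y + z := by
    have h1 : 0 < 2 * (1 + x + y + z) * D := by rw [← hsin]; positivity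
    have h2 := pos_of_mul_pos_left h1 hD.le
    linarith
  obtain ⟨n, hn0, hn2⟩ : ∃ n : ℝ, 0 < n ∧ n ^ 2 = 2 * (1 + x) * (1 + y) * (1 + z) :=
    ⟨_, Real.sqrt_pos.2 (by positivity), Real.sq_sqrt (by positivity)⟩
  generalize Real.cos (c / 2) = k at *
  generalize Real.sin (c / 2) = s at *
  generalize Real.cos (τ / 2) = q at *
  generalize Real.sin (τ / 2) = t at *
  rw [← hn2] at hN hcos hsin
  have hnq : n * q = 1 + x + y + z := by
    refine (pow_left_inj₀ (by positivity) hp.le two_ne_zero).1 ?_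
    linear_combination (n ^ 2 / 2) * hq2 + hcos / 2 - hN / 2
  have hnt : n * t = D := by
    refine (pow_left_inj₀ (by positivity) hD.le two_ne_zero).1 ?_
    linear_combination n ^ 2 * hqt - (n ^ 2 / 2) * hq2 - hcos / 2 - hN / 2
  -- the arithmetic-geometric mean inequality for `1 + x` and `1 + y`
  have hn : n ≤ k * (2 + x + y) := by
    refine (pow_le_pow_iff_left₀ hn0.le (mul_nonneg hk0.le (by linarith)) two_ne_zero).1 ?_
    have e : (k * (2 + x + y)) ^ 2 = n ^ 2 + k ^ 2 * (x - y) ^ 2 := by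
      rw [hn2, ← hk2]; ring
    rw [e]
    linarith [mul_nonneg (sq_nonneg k) (sq_nonneg (x - y))]
  have hmul : n * (D * (1 - q * k)) ≤ n * (2 * k * (1 - k ^ 2) * t) := by
    have e1 : n * (D * (1 - q * k)) = D * (n - k * (1 + x + y + z)) := by rw [← hnq]; ring
    have e2 : n * (2 * k * (1 - k ^ 2) * t) = D * (k * (1 - z)) := by
      rw [← hnt]; linear_combination -(n * t * k) * hk2
    rw [e1, e2]
    refine mul_le_mul_of_nonneg_left ?_ hD.le
    linarith
  have hfin := le_of_mul_le_mul_left hmul hn0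
  rw [div_le_iff₀ (by norm_num), mul_comm (1 / 6 : ℝ), mul_assoc]
  norm_num
  rwa [le_div_iff₀ hu]

/-! ### Faces, cones and the tiling of the sphere -/

theorem toSphere_plane {n : E3} (hn : n ≠ 0) :
    (volume : Measure E3).toSphere {u : Metric.sphere (0 : E3) 1 | inner ℝ n (u : E3) = 0} = 0 := by
  have hK : MeasurableSet {x : E3 | inner ℝ n x = 0} :=
    measurableSet_eq_fun (by fun_prop) measurable_const
  have h := toSphere_real_cone hK (by
    intro r hr x hx
    change inner ℝ n (r • x) = 0
    rw [inner_smul_right, show inner ℝ n x = 0 from hx, mul_zero])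
  have h0 : volume {x : E3 | inner ℝ n x = 0} = 0 := by
    have := ae_inner_ne_zero hn
    rw [ae_iff] at this
    simpa using this
  have h1 : volume.real (Metric.ball (0 : E3) 1 ∩ {x : E3 | inner ℝ n x = 0}) = 0 := by
    rw [Measure.real, measure_mono_null Set.inter_subset_right h0, ENNReal.toReal_zero]
  rw [h1, mul_zero, Measure.real, ENNReal.toReal_eq_zero_iff] at h
  exact h.resolve_right (measure_ne_top _ _)

theorem exists_normal_of_triple_eq_zero {A B C : E3} (h : triple A B C = 0) :
    ∃ n : E3, n ≠ 0 ∧ inner ℝ n A = 0 ∧ inner ℝ n B = 0 ∧ inner ℝ n C = 0 := by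
  have hdet : (!![A 0, A 1, A 2; B 0, B 1, B 2; C 0, C 1, C 2] : Matrix (Fin 3) (Fin 3) ℝ).det = 0 := by
    rw [Matrix.det_fin_three, ← h]
    simp [triple]; ring
  obtain ⟨v, hv, hMv⟩ := Matrix.exists_mulVec_eq_zero_iff.2 hdet
  refine ⟨WithLp.toLp 2 v, ?_, ?_, ?_, ?_⟩
  · intro h0
    exact hv (by simpa using congrArg WithLp.ofLp h0)
  · have := congrFun hMv 0
    simp [Matrix.mulVec, dotProduct, Fin.sum_univ_three] at this
    rw [inner_eq_coords]; simp; linarith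
  · have := congrFun hMv 1
    simp [Matrix.mulVec, dotProduct, Fin.sum_univ_three] at this
    rw [inner_eq_coords]; simp; linarith
  · have := congrFun hMv 2
    simp [Matrix.mulVec, dotProduct, Fin.sum_univ_three] at this
    rw [inner_eq_coords]; simp; linarith

theorem inner_eq_of_mem_convexHull {S : Set E3} {n : E3} {t : ℝ} (h : ∀ y ∈ S, inner ℝ n y = t) {x : E3}
    (hx : x ∈ convexHull ℝ S) : inner ℝ n x = t := by
  have hconv : Convex ℝ {x : E3 | inner ℝ n x = t} := by
    intro x hx y hy a b ha hb hab
    change inner ℝ n (a • x + b • y) = t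
    rw [inner_add_right, inner_smul_right, inner_smul_right, show inner ℝ n x = t from hx,
      show inner ℝ n y = t from hy, ← add_mul, hab, one_mul]
  exact convexHull_min (fun y hy => h y hy) hconv hx

theorem centralProjection_subset_plane {S : Set E3} {n : E3} (h : ∀ y ∈ S, inner ℝ n y = 0) :
    centralProjection (convexHull ℝ S) ⊆ {u | inner ℝ n (u : E3) = 0} := by
  rintro u ⟨r, hr, hu⟩
  have := inner_eq_of_mem_convexHull h hu
  rw [inner_smul_right] at this
  exact (mul_eq_zero.1 this).resolve_left hr.ne'

theorem triple_ne_zero_of_sphericalArea_pos {A B C : E3}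
    (h : 0 < sphericalArea (convexHull ℝ ({A, B, C} : Set E3))) : triple A B C ≠ 0 := by
  intro h0
  obtain ⟨n, hn, hA, hB, hC⟩ := exists_normal_of_triple_eq_zero h0
  have hsub := centralProjection_subset_plane (S := {A, B, C}) (n := n) (by
    rintro y (rfl | rfl | rfl) <;> assumption)
  have : sphericalArea (convexHull ℝ ({A, B, C} : Set E3)) = 0 := by
    rw [sphericalArea, Measure.real, measure_mono_null hsub (toSphere_plane hn),
      ENNReal.toReal_zero]
  linarith

theorem maxArc_mem {F : Finset E3} (hF : F.Nonempty) :
    ∃ x ∈ F, ∃ y ∈ F, maxArc F = InnerProductGeometry.angle x y := by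
  have hfin : {d : ℝ | ∃ x ∈ F, ∃ y ∈ F, d = InnerProductGeometry.angle x y}.Finite := by
    refine ((F ×ˢ F).finite_toSet.image fun p => InnerProductGeometry.angle p.1 p.2).subset ?_
    rintro d ⟨x, hx, y, hy, rfl⟩
    exact ⟨(x, y), by simp [hx, hy], rfl⟩
  obtain ⟨x, hx⟩ := hF
  have hne : {d : ℝ | ∃ x ∈ F, ∃ y ∈ F, d = InnerProductGeometry.angle x y}.Nonempty :=
    ⟨InnerProductGeometry.angle x x, x, hx, x, hx, rfl⟩
  exact hne.csSup_mem hfin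

/-- The vertices of a face, listed so that `A B` is a longest edge and the orientation is positive. -/
theorem exists_positive_labelling {F : Finset E3} (hcard : F.card = 3) (hnorm : ∀ x ∈ F, ‖x‖ = 1)
    (hτ : 0 < sphericalArea (convexHull ℝ (F : Set E3))) (hc : 0 < maxArc F) :
    ∃ A B C : E3, (F : Set E3) = {A, B, C} ∧ 0 < triple A B C ∧
      maxArc F = InnerProductGeometry.angle A B := by
  classical
  obtain ⟨x, hx, y, hy, hxy⟩ := maxArc_mem (Finset.card_pos.1 (by rw [hcard]; norm_num))
  have hne : x ≠ y := by
    rintro rfl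
    have h0 : x ≠ 0 := norm_ne_zero_iff.1 (by rw [hnorm x hx]; exact one_ne_zero)
    rw [InnerProductGeometry.angle_self h0] at hxy
    linarith
  have hcard2 : ((F.erase x).erase y).card = 1 := by
    rw [Finset.card_erase_of_mem (Finset.mem_erase.2 ⟨hne.symm, hy⟩), Finset.card_erase_of_mem hx,
      hcard]
  obtain ⟨z, hz⟩ := Finset.card_eq_one.1 hcard2
  have hF : F = {x, y, z} := by
    rw [← hz, Finset.insert_erase (Finset.mem_erase.2 ⟨hne.symm, hy⟩), Finset.insert_erase hx]
  have hF' : (F : Set E3) = {x, y, z} := by rw [hF]; simp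
  have hD := triple_ne_zero_of_sphericalArea_pos (by rwa [← hF'])
  rcases lt_or_gt_of_ne hD with h | h
  · refine ⟨y, x, z, ?_, ?_, ?_⟩
    · rw [hF', Set.insert_comm]
    · rw [triple_swap]; linarith
    · rw [hxy, InnerProductGeometry.angle_comm]
  · exact ⟨x, y, z, hF', h, hxy⟩

theorem measurableSet_centralProjection {A B C : E3} (hD : 0 < triple A B C) :
    MeasurableSet (centralProjection (convexHull ℝ ({A, B, C} : Set E3))) := by
  have hclosed : ∀ n : E3, MeasurableSet {u : Metric.sphere (0 : E3) 1 | 0 ≤ inner ℝ n (u : E3)} :=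
    fun n => measurableSet_le measurable_const (by fun_prop)
  have e : centralProjection (convexHull ℝ ({A, B, C} : Set E3)) =
      {u : Metric.sphere (0 : E3) 1 | 0 ≤ inner ℝ (cross B C) (u : E3)} ∩
        ({u : Metric.sphere (0 : E3) 1 | 0 ≤ inner ℝ (cross C A) (u : E3)} ∩
          {u : Metric.sphere (0 : E3) 1 | 0 ≤ inner ℝ (cross A B) (u : E3)}) := by
    ext u
    exact exists_smul_mem_convexHull_iff hD (norm_ne_zero_iff.1 (by simp))
  rw [e]
  exact (hclosed _).inter ((hclosed _).inter (hclosed _))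

/-- The affine plane of a nondegenerate triangle, as a level set of a linear functional. -/
theorem exists_support_normal {A B C : E3} (hD : 0 < triple A B C) :
    ∃ n : E3, ∀ y ∈ ({A, B, C} : Set E3), inner ℝ n y = 1 := by
  have key : ∀ x, inner ℝ ((triple A B C)⁻¹ • (cross B C + cross C A + cross A B)) x =
      (triple A B C)⁻¹ * (triple x B C + triple x C A + triple x A B) := by
    intro x
    rw [real_inner_smul_left, inner_add_left, inner_add_left, inner_cross, inner_cross, inner_cross]
  refine ⟨(triple A B C)⁻¹ • (cross B C + cross C A + cross A B), fun y hy => ?_⟩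
  rw [key, inv_mul_eq_one₀ hD.ne']
  rcases hy with rfl | rfl | rfl <;> simp only [triple] <;> ring

/-- A plane through the centre that contains the vertices of a triangle other than `v`. -/
theorem exists_edge_normal {A B C v : E3} (hD : 0 < triple A B C) (hv : v ∈ ({A, B, C} : Set E3)) :
    ∃ n : E3, n ≠ 0 ∧ ∀ y ∈ ({A, B, C} : Set E3), y ≠ v → inner ℝ n y = 0 := by
  have hn : ∀ {y z x : E3}, triple x y z ≠ 0 → cross y z ≠ 0 := by
    intro y z x h h0
    rw [← inner_cross, h0, inner_zero_left] at h
    exact h rfl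
  rcases hv with rfl | rfl | rfl
  · refine ⟨cross B C, hn hD.ne', ?_⟩
    rintro y (rfl | rfl | rfl) h
    · exact absurd rfl h
    all_goals rw [inner_cross]; simp only [triple]; ring
  · refine ⟨cross C A, hn (x := v) (by rw [triple_rotate]; exact hD.ne'), ?_⟩
    rintro y (rfl | rfl | rfl) h
    · rw [inner_cross]; simp only [triple]; ring
    · exact absurd rfl h
    · rw [inner_cross]; simp only [triple]; ring
  · refine ⟨cross A B, hn (x := v) (by rw [← triple_rotate]; exact hD.ne'), ?_⟩
    rintro y (rfl | rfl | rfl) h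
    · rw [inner_cross]; simp only [triple]; ring
    · rw [inner_cross]; simp only [triple]; ring
    · exact absurd rfl h

/-- The standard simplex occupies at most an eighth of the octahedron. -/
theorem volume_simplex_le :
    volume {p : Fin 3 → ℝ | (∀ i, 0 ≤ p i) ∧ ∑ i, p i ≤ 1} ≤ ENNReal.ofReal (1 / 6) := by
  set T : Set (Fin 3 → ℝ) := {p | (∀ i, 0 < p i) ∧ ∑ i, p i ≤ 1} with hT
  have hTm : MeasurableSet T := by
    have h1 : ∀ i, MeasurableSet {p : Fin 3 → ℝ | 0 < p i} := fun i =>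
      measurableSet_lt measurable_const (measurable_pi_apply i)
    have h2 : MeasurableSet {p : Fin 3 → ℝ | ∑ i, p i ≤ 1} :=
      measurableSet_le (by fun_prop) measurable_const
    have e : T = (⋂ i, {p : Fin 3 → ℝ | 0 < p i}) ∩ {p : Fin 3 → ℝ | ∑ i, p i ≤ 1} := by
      ext p
      simp [hT]
    rw [e]
    exact (MeasurableSet.iInter h1).inter h2
  have hae : ∀ᵐ p : Fin 3 → ℝ, ∀ i, p i ≠ 0 := by
    rw [ae_all_iff]
    intro i
    rw [ae_iff]
    simp only [not_not]
    exact Measure.pi_hyperplane (fun _ : Fin 3 => (volume : Measure ℝ)) i 0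
  have hTeq : volume {p : Fin 3 → ℝ | (∀ i, 0 ≤ p i) ∧ ∑ i, p i ≤ 1} = volume T := by
    refine measure_congr (Filter.eventuallyEq_set.2 ?_)
    filter_upwards [hae] with p hp
    refine and_congr (forall_congr' fun i => ?_) Iff.rfl
    exact ⟨fun h => lt_of_le_of_ne h (hp i).symm, le_of_lt⟩
  -- the eight reflected copies of the simplex fill the octahedron
  let R : (Fin 3 → Bool) → (Fin 3 → ℝ) → (Fin 3 → ℝ) := fun s p i =>
    if s i then p i else -p i
  have hR : ∀ s, MeasurePreserving (R s) := fun s =>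
    volume_preserving_pi (f := fun i (x : ℝ) => if s i then x else -x) fun i => by
      cases s i
      · simpa using Measure.measurePreserving_neg (volume : Measure ℝ)
      · exact MeasurePreserving.id (volume : Measure ℝ)
  have hdisj : Pairwise (Function.onFun Disjoint fun s => R s ⁻¹' T) := by
    intro s t hst
    rw [Function.onFun, Set.disjoint_left]
    intro p hp hq
    apply hst
    ext i
    have h1 : 0 < R s p i := hp.1 i
    have h2 : 0 < R t p i := hq.1 i
    simp only [R] at h1 h2
    cases hs : s i <;> cases ht : t i <;> simp [hs, ht] at h1 h2 ⊢ <;> linarith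
  have hsub : (⋃ s, R s ⁻¹' T) ⊆ {p : Fin 3 → ℝ | (∑ i, |p i| ^ (1 : ℝ)) ^ (1 / (1 : ℝ)) ≤ 1} := by
    rintro p hp
    obtain ⟨s, hp⟩ := Set.mem_iUnion.1 hp
    have h1 : ∀ i, R s p i = |p i| := by
      intro i
      have h0 : 0 < R s p i := hp.1 i
      have h2 : |R s p i| = |p i| := by
        simp only [R]; split_ifs <;> simp
      rw [← h2, abs_of_pos h0]
    have h3 : ∑ i, R s p i ≤ 1 := hp.2
    simp only [h1] at h3
    change (∑ i, |p i| ^ (1 : ℝ)) ^ (1 / (1 : ℝ)) ≤ 1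
    simpa using h3
  have hmeas := measure_mono (μ := volume) hsub
  rw [measure_iUnion hdisj (fun s => (hR s).measurable hTm), tsum_fintype,
    volume_sum_rpow_le (Fin 3) le_rfl] at hmeas
  simp only [fun s => (hR s).measure_preimage hTm.nullMeasurableSet] at hmeas
  have hΓ1 : Real.Gamma (1 / 1 + 1) = 1 := by norm_num
  have hΓ3 : Real.Gamma ((Fintype.card (Fin 3) : ℝ) / 1 + 1) = 6 := by
    have := Real.Gamma_nat_eq_factorial 3
    simp only [Fintype.card_fin, div_one]
    rw [this]; norm_num [Nat.factorial]
  rw [hΓ1, hΓ3] at hmeas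
  simp at hmeas
  rw [hTeq]
  have h8 : (8 : ENNReal) * volume T ≤ 8 * ENNReal.ofReal (1 / 6) := by
    refine hmeas.trans (le_of_eq ?_)
    rw [show (8 : ENNReal) = ENNReal.ofReal 8 by norm_num, ← ENNReal.ofReal_mul (by norm_num)]
    norm_num
  exact (ENNReal.mul_le_mul_iff_right (by norm_num) (by norm_num)).1 h8

/-- Volume of the tetrahedron spanned by a triangle and the centre. -/
theorem volume_cone_le {A B C : E3} (hD : 0 < triple A B C) :
    volume {x : E3 | ∃ s : ℝ, 0 ≤ s ∧ s ≤ 1 ∧ ∃ y ∈ convexHull ℝ ({A, B, C} : Set E3), x = s • y} ≤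
      ENNReal.ofReal (triple A B C / 6) := by
  obtain ⟨hAB, hAC, hBC⟩ := ne_of_triple_ne_zero hD.ne'
  set M : Matrix (Fin 3) (Fin 3) ℝ := !![A 0, B 0, C 0; A 1, B 1, C 1; A 2, B 2, C 2] with hM
  have hdet : M.det = triple A B C := by
    rw [hM, Matrix.det_fin_three]; simp [triple]; ring
  have hsub : {x : E3 | ∃ s : ℝ, 0 ≤ s ∧ s ≤ 1 ∧
      ∃ y ∈ convexHull ℝ ({A, B, C} : Set E3), x = s • y} ⊆
      WithLp.ofLp ⁻¹' (Matrix.toLin' M '' {p : Fin 3 → ℝ | (∀ i, 0 ≤ p i) ∧ ∑ i, p i ≤ 1}) := by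
    rintro _ ⟨s, hs0, hs1, y, hy, rfl⟩
    rw [convexHull_triple hAB hAC hBC] at hy
    obtain ⟨a, b, c, ha, hb, hc, habc, rfl⟩ := hy
    refine ⟨![s * a, s * b, s * c], ⟨?_, ?_⟩, ?_⟩
    · intro i
      fin_cases i <;> simp <;> positivity
    · simp only [Fin.sum_univ_three, Matrix.cons_val_zero, Matrix.cons_val_one, Matrix.cons_val]
      calc s * a + s * b + s * c = s * (a + b + c) := by ring
        _ ≤ 1 := by rw [habc, mul_one]; exact hs1
    · ext i
      fin_cases i <;>
        simp [hM, Matrix.toLin'_apply, Matrix.mulVec, dotProduct, Fin.sum_univ_three] <;> ring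
  refine (measure_mono hsub).trans ?_
  rw [(PiLp.volume_preserving_ofLp (Fin 3)).measure_preimage_emb
    (MeasurableEquiv.toLp 2 (Fin 3 → ℝ)).symm.measurableEmbedding,
    Measure.addHaar_image_linearMap, LinearMap.det_toLin', hdet, abs_of_pos hD, div_eq_mul_one_div,
    ENNReal.ofReal_mul hD.le]
  gcongr
  exact volume_simplex_le

theorem exists_smul_mem_frontier {K : Set E3} (hK : IsCompact K) {x : E3} (hx : x ∈ K)
    (hx0 : x ≠ 0) : ∃ r : ℝ, 1 ≤ r ∧ r • x ∈ frontier K := by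
  have hcont : Continuous fun r : ℝ => r • x := by fun_prop
  have hclosed : IsClosed {r : ℝ | r • x ∈ K} := hK.isClosed.preimage hcont
  obtain ⟨R, hR⟩ := hK.isBounded.subset_closedBall (0 : E3)
  have hxn : 0 < ‖x‖ := norm_pos_iff.2 hx0
  have hbdd : Bornology.IsBounded {r : ℝ | r • x ∈ K} := by
    refine (Metric.isBounded_closedBall (x := (0 : ℝ)) (r := R / ‖x‖)).subset fun r hr => ?_
    have := hR hr
    rw [mem_closedBall_zero_iff, norm_smul] at this
    rwa [mem_closedBall_zero_iff, le_div_iff₀ hxn]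
  have h1 : (1 : ℝ) ∈ {r : ℝ | r • x ∈ K} := by
    change (1 : ℝ) • x ∈ K
    rwa [one_smul]
  obtain ⟨r, hr, hmax⟩ := (Metric.isCompact_of_isClosed_isBounded hclosed hbdd).exists_isGreatest
    ⟨1, h1⟩
  refine ⟨r, hmax h1, ?_⟩
  rw [hK.isClosed.frontier_eq]
  refine ⟨hr, fun hint => ?_⟩
  have hopen : IsOpen {r : ℝ | r • x ∈ interior K} := isOpen_interior.preimage hcont
  obtain ⟨ε, hε, hball⟩ := Metric.isOpen_iff.1 hopen r hint
  have h2 : r + ε / 2 ∈ Metric.ball r ε := by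
    rw [Metric.mem_ball, Real.dist_eq, add_sub_cancel_left, abs_of_pos (by linarith)]
    linarith
  have h3 : (r + ε / 2) • x ∈ K := interior_subset (hball h2)
  have := hmax h3
  linarith

namespace InscribedStarPolyhedron

variable {f : ℕ}

theorem exists_oriented_faces (P : InscribedStarPolyhedron f) (hτ : ∀ i, 0 < P.tau i)
    (hc : ∀ i, 0 < P.maxEdge i) :
    ∃ A B C : Fin f → E3, ∀ i, (P.face i : Set E3) = {A i, B i, C i} ∧
      0 < triple (A i) (B i) (C i) ∧ P.maxEdge i = InnerProductGeometry.angle (A i) (B i) := by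
  choose A B C h using fun i =>
    exists_positive_labelling (P.card_face i) (P.norm_vertex i) (hτ i) (hc i)
  exact ⟨A, B, C, h⟩

theorem exists_face_functional (P : InscribedStarPolyhedron f) (hτ : ∀ i, 0 < P.tau i)
    (hc : ∀ i, 0 < P.maxEdge i) (i : Fin f) :
    ∃ n : E3, ∀ y ∈ convexHull ℝ (P.face i : Set E3), inner ℝ n y = 1 := by
  obtain ⟨A, B, C, h⟩ := P.exists_oriented_faces hτ hc
  obtain ⟨n, hn⟩ := exists_support_normal (h i).2.1
  refine ⟨n, fun y hy => ?_⟩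
  rw [(h i).1] at hy
  exact inner_eq_of_mem_convexHull hn hy

theorem zero_mem_interior (P : InscribedStarPolyhedron f) (hτ : ∀ i, 0 < P.tau i)
    (hc : ∀ i, 0 < P.maxEdge i) : (0 : E3) ∈ interior P.body := by
  obtain ⟨x, hx⟩ := P.interior_nonempty
  have h0 : (0 : E3) ∈ P.body := by
    have := P.starConvex.smul_mem (interior_subset hx) le_rfl zero_le_one
    rwa [zero_smul] at this
  by_contra hint
  have hfr : (0 : E3) ∈ frontier P.body := by
    rw [P.isCompact_body.isClosed.frontier_eq]; exact ⟨h0, hint⟩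
  rw [P.frontier_body] at hfr
  obtain ⟨i, hi⟩ := Set.mem_iUnion.1 hfr
  obtain ⟨n, hn⟩ := P.exists_face_functional hτ hc i
  have := hn 0 hi
  rw [inner_zero_right] at this
  exact zero_ne_one this

/-- A ray from the centre meets the boundary only once: otherwise a whole segment of the ray lies in
the boundary, hence two of its points in one face, whose plane would pass through the centre. -/
theorem ray_frontier_unique (P : InscribedStarPolyhedron f) (hτ : ∀ i, 0 < P.tau i)
    (hc : ∀ i, 0 < P.maxEdge i) {u : E3} {r₁ r₂ : ℝ} (h0 : 0 < r₁)
    (h₁ : r₁ • u ∈ frontier P.body) (h₂ : r₂ • u ∈ frontier P.body) : r₂ ≤ r₁ := by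
  by_contra! hlt
  have hcl := P.isCompact_body.isClosed
  have hseg : ∀ r ∈ Set.Icc r₁ r₂, r • u ∈ frontier P.body := by
    rintro r ⟨hr1, hr2⟩
    have hr0 : 0 < r := by linarith
    have hr20 : 0 < r₂ := by linarith
    rw [hcl.frontier_eq] at h₁ h₂ ⊢
    refine ⟨?_, fun hint => h₁.2 ?_⟩
    · have := P.starConvex.smul_mem h₂.1 (t := r / r₂) (by positivity)
        ((div_le_one hr20).2 hr2)
      rwa [smul_smul, div_mul_cancel₀ _ hr20.ne'] at this
    · -- shrinking a neighbourhood of an interior point towards the centre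
      have hopen : IsOpen ((fun x : E3 => (r / r₁) • x) ⁻¹' interior P.body) :=
        isOpen_interior.preimage (by fun_prop)
      refine mem_interior.2 ⟨_, ?_, hopen, ?_⟩
      · intro x hx
        have := P.starConvex.smul_mem (interior_subset hx) (t := r₁ / r) (by positivity)
          ((div_le_one hr0).2 hr1)
        rwa [smul_smul, div_mul_div_cancel₀ hr0.ne', div_self h0.ne', one_smul] at this
      · change (r / r₁) • (r₁ • u) ∈ interior P.body
        rwa [smul_smul, div_mul_cancel₀ _ h0.ne']
  have hface : ∀ r : Set.Icc r₁ r₂, ∃ i, (r : ℝ) • u ∈ convexHull ℝ (P.face i : Set E3) := by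
    intro r
    have := hseg r r.2
    rw [P.frontier_body] at this
    exact Set.mem_iUnion.1 this
  choose g hg using hface
  have hinf : Infinite (Set.Icc r₁ r₂) := (Set.Icc_infinite hlt).to_subtype
  obtain ⟨r, s, hrs, hgrs⟩ := Finite.exists_ne_map_eq_of_infinite g
  obtain ⟨n, hn⟩ := P.exists_face_functional hτ hc (g r)
  have e1 := hn _ (hg r)
  have e2 := hn ((s : ℝ) • u) (by rw [hgrs]; exact hg s)
  rw [inner_smul_right] at e1 e2
  have hne : inner ℝ n u ≠ 0 := by
    intro h; rw [h, mul_zero] at e1; exact zero_ne_one e1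
  exact hrs (Subtype.ext (mul_right_cancel₀ hne (e1.trans e2.symm)))

/-- The body is covered by the tetrahedra over its faces. -/
theorem vol_le (P : InscribedStarPolyhedron f) {A B C : Fin f → E3}
    (h : ∀ i, (P.face i : Set E3) = {A i, B i, C i} ∧ 0 < triple (A i) (B i) (C i)) :
    P.vol ≤ ∑ i, triple (A i) (B i) (C i) / 6 := by
  have hsub : P.body ⊆ {0} ∪ ⋃ i, {x : E3 | ∃ s : ℝ, 0 ≤ s ∧ s ≤ 1 ∧
      ∃ y ∈ convexHull ℝ ({A i, B i, C i} : Set E3), x = s • y} := by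
    intro x hx
    by_cases hx0 : x = 0
    · exact Or.inl hx0
    · right
      obtain ⟨r, hr, hfr⟩ := exists_smul_mem_frontier P.isCompact_body hx hx0
      rw [P.frontier_body] at hfr
      obtain ⟨i, hi⟩ := Set.mem_iUnion.1 hfr
      rw [(h i).1] at hi
      have hr0 : 0 < r := by linarith
      exact Set.mem_iUnion.2 ⟨i, r⁻¹, by positivity, inv_le_one_of_one_le₀ hr, r • x, hi,
        (inv_smul_smul₀ hr0.ne' x).symm⟩
  have hle : volume P.body ≤ ENNReal.ofReal (∑ i, triple (A i) (B i) (C i) / 6) := by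
    refine (measure_mono hsub).trans ((measure_union_le _ _).trans ?_)
    rw [measure_singleton, zero_add, ENNReal.ofReal_sum_of_nonneg fun i _ => by
      have := (h i).2; positivity]
    refine (measure_iUnion_le _).trans ?_
    rw [tsum_fintype]
    exact Finset.sum_le_sum fun i _ => volume_cone_le (h i).2
  exact ENNReal.toReal_le_of_le_ofReal (Finset.sum_nonneg fun i _ => by
    have := (h i).2; positivity) hle

theorem exists_mem_centralProjection (P : InscribedStarPolyhedron f) (hτ : ∀ i, 0 < P.tau i)
    (hc : ∀ i, 0 < P.maxEdge i) (u : Metric.sphere (0 : E3) 1) :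
    ∃ i, u ∈ centralProjection (convexHull ℝ (P.face i : Set E3)) := by
  have hu : (u : E3) ≠ 0 := norm_ne_zero_iff.1 (by simp)
  have hopen : IsOpen ((fun r : ℝ => r • (u : E3)) ⁻¹' interior P.body) :=
    isOpen_interior.preimage (by fun_prop)
  obtain ⟨ε, hε, hball⟩ := Metric.isOpen_iff.1 hopen 0 (by
    change (0 : ℝ) • (u : E3) ∈ interior P.body
    rw [zero_smul]; exact P.zero_mem_interior hτ hc)
  have hmem : (ε / 2) • (u : E3) ∈ P.body := interior_subset (hball (by
    rw [Metric.mem_ball, Real.dist_eq, sub_zero, abs_of_pos (by linarith)]; linarith))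
  obtain ⟨r, hr, hfr⟩ := exists_smul_mem_frontier P.isCompact_body hmem
    (smul_ne_zero (by positivity) hu)
  rw [P.frontier_body] at hfr
  obtain ⟨i, hi⟩ := Set.mem_iUnion.1 hfr
  rw [smul_smul] at hi
  exact ⟨i, r * (ε / 2), by positivity, hi⟩

/-- The central projections of the faces tile the sphere. -/
theorem sum_tau (P : InscribedStarPolyhedron f) (hτ : ∀ i, 0 < P.tau i)
    (hc : ∀ i, 0 < P.maxEdge i) : ∑ i, P.tau i = 4 * Real.pi := by
  obtain ⟨A, B, C, h⟩ := P.exists_oriented_faces hτ hc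
  have hmeas : ∀ i, MeasurableSet (centralProjection (convexHull ℝ (P.face i : Set E3))) := by
    intro i
    rw [(h i).1]
    exact measurableSet_centralProjection (h i).2.1
  have hdisj : Pairwise (Function.onFun (AEDisjoint (volume : Measure E3).toSphere)
      fun i => centralProjection (convexHull ℝ (P.face i : Set E3))) := by
    intro i j hij
    obtain ⟨v, hvi, hvj⟩ : ∃ v ∈ P.face i, v ∉ P.face j := by
      by_contra! hsub
      refine hij (P.face_injective (Finset.eq_of_subset_of_card_le hsub ?_))
      rw [P.card_face, P.card_face]
    obtain ⟨n, hn, hn0⟩ := exists_edge_normal (v := v) (h i).2.1 (by rw [← (h i).1]; exact hvi)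
    refine measure_mono_null ?_ (toSphere_plane hn)
    rintro u ⟨⟨r, hr, hri⟩, ⟨s, hs, hsj⟩⟩
    have hrf : r • (u : E3) ∈ frontier P.body := by
      rw [P.frontier_body]; exact Set.mem_iUnion.2 ⟨i, hri⟩
    have hsf : s • (u : E3) ∈ frontier P.body := by
      rw [P.frontier_body]; exact Set.mem_iUnion.2 ⟨j, hsj⟩
    obtain rfl : r = s := le_antisymm (P.ray_frontier_unique hτ hc hs hsf hrf)
      (P.ray_frontier_unique hτ hc hr hrf hsf)
    have hmem := P.inter_face i j ⟨hri, hsj⟩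
    refine centralProjection_subset_plane (S := (P.face i : Set E3) ∩ P.face j) ?_ ⟨r, hr, hmem⟩
    rintro y ⟨hyi, hyj⟩
    refine hn0 y (by rw [← (h i).1]; exact hyi) ?_
    rintro rfl
    exact hvj hyj
  have hunion : (⋃ i, centralProjection (convexHull ℝ (P.face i : Set E3))) = Set.univ :=
    Set.eq_univ_of_forall fun u => Set.mem_iUnion.2 (P.exists_mem_centralProjection hτ hc u)
  have hsum := measure_iUnion₀ hdisj fun i => (hmeas i).nullMeasurableSet
  rw [hunion, tsum_fintype] at hsum
  have hreal := congrArg ENNReal.toReal hsum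
  rw [ENNReal.toReal_sum fun i _ => measure_ne_top _ _] at hreal
  have huniv := Measure.toSphere_real_apply_univ (volume : Measure E3)
  rw [Measure.real, Measure.real, EuclideanSpace.volume_ball_fin_three, ENNReal.ofReal_one,
    one_pow, one_mul, ENNReal.toReal_ofReal (by positivity), finrank_euclideanSpace_fin] at huniv
  rw [huniv] at hreal
  refine hreal.symm.trans ?_
  push_cast
  ring

end InscribedStarPolyhedron

/-! ### The volume bound -/

theorem tetraEdge_lt_pi : tetraEdge < Real.pi := by
  have h : Real.arcsin (Real.sqrt (2 / 3)) < Real.pi / 2 := by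
    rw [Real.arcsin_lt_pi_div_two, Real.sqrt_lt' one_pos]
    norm_num
  unfold tetraEdge
  linarith

theorem mem_concavityDomain_of_le_hessianZero {τ c : ℝ} (hτ : 0 < τ) (hτc : τ ≤ c)
    (hc : c ≤ hessianZero τ) (hcπ : c < Real.pi) : (τ / 2, c / 2) ∈ concavityDomain := by
  refine ⟨?_, ?_, ?_, concavityPoly_nonneg_of_le_hessianZero hτ hτc hc hcπ⟩ <;> simp only <;>
    linarith

/-- Beyond `hessianZero τ` the function `v(τ, ·)` stays below its value there. -/
theorem facialBound_le_hessianZero {τ c : ℝ} (hτ : 0 < τ) (h0 : 0 < hessianZero τ)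
    (hc : hessianZero τ ≤ c) (hcπ : c < Real.pi) :
    facialBound τ c ≤ facialBound τ (hessianZero τ) := by
  obtain ⟨hle, hpoly⟩ := concavityPoly_hessianZero hτ h0
  have hk : 0 < Real.cos (hessianZero τ / 2) :=
    Real.cos_pos_of_mem_Ioo ⟨by linarith, by linarith⟩
  have hk1 : Real.cos (hessianZero τ / 2) < 1 := by
    rw [← Real.cos_zero]
    exact Real.cos_lt_cos_of_nonneg_of_le_pi_div_two le_rfl (by linarith) (by linarith)
  have hkq : Real.cos (hessianZero τ / 2) ≤ Real.cos (τ / 2) :=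
    Real.cos_le_cos_of_nonneg_of_le_pi (by linarith) (by linarith) (by linarith)
  have hN := slope_nonneg_of_concavityPoly_eq_zero hk hkq (Real.cos_le_one _) hk1 hpoly
  rw [facialBound_eq_halfBound, facialBound_eq_halfBound]
  exact mul_le_mul_of_nonneg_left (halfBound_le_of_slope_nonneg (by linarith) (by linarith)
    (by linarith) (by linarith) hN) (by norm_num)

theorem InscribedStarPolyhedron.vol_le_facialBound {f : ℕ} (P : InscribedStarPolyhedron f)
    (hτ : ∀ i, 0 < P.tau i ∧ P.tau i < Real.pi / 2) (hc : ∀ i, 0 < P.maxEdge i) (c : Fin f → ℝ)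
    (hmem : ∀ i, (P.tau i / 2, c i / 2) ∈ concavityDomain)
    (hle : ∀ i, facialBound (P.tau i) (P.maxEdge i) ≤ facialBound (P.tau i) (c i)) :
    0 < f ∧ P.vol ≤ f * facialBound (4 * Real.pi / f) ((∑ i, c i) / f) := by
  have hτ0 : ∀ i, 0 < P.tau i := fun i => (hτ i).1
  obtain ⟨A, B, C, h⟩ := P.exists_oriented_faces hτ0 hc
  have hf : 0 < f := by
    obtain ⟨i, -⟩ := P.exists_mem_centralProjection hτ0 hc
      ⟨EuclideanSpace.single 0 1, by simp⟩
    exact i.pos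
  refine ⟨hf, (P.vol_le fun i => ⟨(h i).1, (h i).2.1⟩).trans ?_⟩
  rw [← P.sum_tau hτ0 hc]
  refine le_trans (Finset.sum_le_sum fun i _ => ?_) (sum_facialBound_le hf P.tau c hmem)
  have hnorm : ∀ x ∈ ({A i, B i, C i} : Set E3), ‖x‖ = 1 := by
    intro x hx
    rw [← (h i).1] at hx
    exact P.norm_vertex i x hx
  refine le_trans ?_ (hle i)
  rw [(h i).2.2]
  refine triple_le_facialBound (hnorm _ (by simp)) (hnorm _ (by simp)) (hnorm _ (by simp))
    (h i).2.1 ?_ (hτ i).1 (hτ i).2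
  rw [← (h i).1]
  rfl

end

theorem theorem1 {f : ℕ} (P : InscribedStarPolyhedron f) (f' : ℕ) (hf' : f' ≤ f)
    (hτ : ∀ i, 0 < P.tau i ∧ P.tau i < Real.pi / 2)
    (hD : ∀ i : Fin f, (i : ℕ) < f' →
      P.tau i ≤ P.maxEdge i ∧ P.maxEdge i ≤ min (hessianZero (P.tau i)) tetraEdge)
    (hD' : ∀ j : Fin f, f' ≤ (j : ℕ) →
      0 < hessianZero (P.tau j) ∧ hessianZero (P.tau j) ≤ P.maxEdge j ∧ P.maxEdge j ≤ tetraEdge)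
    (c' cs : ℝ)
    (hc' : c' = 1 / (f' : ℝ) * ∑ i : Fin f with i.val < f', P.maxEdge i)
    (hcs : cs = 1 / ((f : ℝ) - f') * ∑ i : Fin f with f' ≤ i.val, hessianZero (P.tau i)) :
    P.vol ≤ (f : ℝ) / 6 * Real.sin ((f' * c' + (f - f') * cs) / f) *
        ((Real.cos ((4 * Real.pi - f' * c' - (f - f') * cs) / (2 * f)) -
            Real.cos (2 * Real.pi / f) * Real.cos ((f' * c' + (f - f') * cs) / (2 * f))) /
          (1 - Real.cos (4 * Real.pi / (2 * f)) *
            Real.cos ((f' * c' + (f - f') * cs) / (2 * f)))) ∧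
    (f' = f →
      P.vol ≤ (f : ℝ) / 6 * Real.sin c' *
        ((Real.cos (2 * Real.pi / f - c' / 2) - Real.cos (2 * Real.pi / f) * Real.cos (c' / 2)) /
          (1 - Real.cos (c' / 2) * Real.cos (2 * Real.pi / f)))) := by
  have hπ := tetraEdge_lt_pi
  have hc : ∀ i, 0 < P.maxEdge i := fun i => by
    rcases lt_or_ge (i : ℕ) f' with hi | hi
    · exact (hτ i).1.trans_le (hD i hi).1
    · exact (hD' i hi).1.trans_le (hD' i hi).2.1
  set c : Fin f → ℝ := fun i => if (i : ℕ) < f' then P.maxEdge i else hessianZero (P.tau i)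
    with hcdef
  have hmem : ∀ i, (P.tau i / 2, c i / 2) ∈ concavityDomain := fun i => by
    rcases lt_or_ge (i : ℕ) f' with hi | hi
    · have := hD i hi
      rw [le_min_iff] at this
      simp only [hcdef, if_pos hi]
      exact mem_concavityDomain_of_le_hessianZero (hτ i).1 this.1 this.2.1 (by linarith)
    · have := hD' i hi
      simp only [hcdef, if_neg hi.not_gt]
      exact mem_concavityDomain_of_le_hessianZero (hτ i).1
        (concavityPoly_hessianZero (hτ i).1 this.1).1 le_rfl (by linarith)
  have hle : ∀ i, facialBound (P.tau i) (P.maxEdge i) ≤ facialBound (P.tau i) (c i) := fun i => by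
    rcases lt_or_ge (i : ℕ) f' with hi | hi
    · simp only [hcdef, if_pos hi, le_refl]
    · have := hD' i hi
      simp only [hcdef, if_neg hi.not_gt]
      exact facialBound_le_hessianZero (hτ i).1 this.1 this.2.1 (by linarith)
  obtain ⟨hf, hvol⟩ := P.vol_le_facialBound hτ hc c hmem hle
  have hf0 : (f : ℝ) ≠ 0 := by exact_mod_cast hf.ne'
  -- an empty class of faces contributes an empty sum, so the junk value of its mean is harmless
  have h1 : (f' : ℝ) * c' = ∑ i : Fin f with i.val < f', P.maxEdge i := by
    rcases eq_or_ne f' 0 with h0 | h0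
    · subst h0; simp
    · have : (f' : ℝ) ≠ 0 := by exact_mod_cast h0
      rw [hc']; field_simp
  have h2 : ((f : ℝ) - f') * cs = ∑ i : Fin f with f' ≤ i.val, hessianZero (P.tau i) := by
    rcases eq_or_ne f' f with h0 | h0
    · subst h0
      rw [sub_self, zero_mul, Finset.filter_false_of_mem fun i _ => not_le.2 i.isLt,
        Finset.sum_empty]
    · have : (f : ℝ) - f' ≠ 0 := sub_ne_zero.2 (by exact_mod_cast h0.symm)
      rw [hcs]; field_simp
  have hsum : ∑ i, c i = f' * c' + (f - f') * cs := by
    rw [h1, h2, hcdef, Finset.sum_ite]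
    simp only [not_lt]
  rw [hsum] at hvol
  have hmain : P.vol ≤ (f : ℝ) / 6 * Real.sin ((f' * c' + (f - f') * cs) / f) *
      ((Real.cos ((4 * Real.pi - f' * c' - (f - f') * cs) / (2 * f)) -
          Real.cos (2 * Real.pi / f) * Real.cos ((f' * c' + (f - f') * cs) / (2 * f))) /
        (1 - Real.cos (4 * Real.pi / (2 * f)) *
          Real.cos ((f' * c' + (f - f') * cs) / (2 * f)))) := by
    refine hvol.trans (le_of_eq ?_)
    unfold facialBound
    rw [show 4 * Real.pi / (2 * f) = 2 * Real.pi / (f : ℝ) by field_simp; norm_num,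
      show (4 * Real.pi / f - (f' * c' + (f - f') * cs) / f) / 2 =
        (4 * Real.pi - f' * c' - (f - f') * cs) / (2 * (f : ℝ)) by field_simp; ring,
      show 4 * Real.pi / f / 2 = 2 * Real.pi / (f : ℝ) by field_simp; norm_num,
      show (f' * c' + (f - f') * cs) / f / 2 = (f' * c' + (f - f') * cs) / (2 * (f : ℝ)) by
        field_simp]
    ring
  refine ⟨hmain, fun hff => ?_⟩
  subst hff
  rw [sub_self, zero_mul, add_zero, sub_zero] at hmain
  rw [show (f' : ℝ) * c' / f' = c' by field_simp,
    show (f' : ℝ) * c' / (2 * f') = c' / 2 by field_simp,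
    show 4 * Real.pi / (2 * f') = 2 * Real.pi / (f' : ℝ) by field_simp; norm_num,
    show (4 * Real.pi - f' * c') / (2 * (f' : ℝ)) = 2 * Real.pi / f' - c' / 2 by
      field_simp; ring] at hmain
  rwa [mul_comm (Real.cos (c' / 2)) (Real.cos (2 * Real.pi / (f' : ℝ)))]
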